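/- Let $G$ be a real reductive group of inner type (in the sense of Wallach: a finite covering of an open subgroup of the group of real points, stable under transposition, of a linear algebraic group defined over $\mathbb{R}$, with $\operatorname{Ad}(G)\subset\operatorname{Int}(\mathfrak g_{\mathbb C})$), $K\subset G$ a maximal compact subgroup, and $V$ a Harish-Chandra module, i.e. a finitely generated $K$-admissible $(\mathfrak g,K)$-module. A norm $p$ on $V$ is called $G$-continuous if the completion $V_p$ carries a continuous representation of $G$ whose $(\mathfrak g,K)$-module of $K$-finite vectors is $V$. Let $\operatorname{Norm}(V)$ be the set of $G$-continuous norms $p$ for which there is a $C>0$ with $p(g\cdot v)\le C\,p(v)$ for all $g\in G$, $v\in V$. For norms $p,q$ on $V$ write $p\lesssim q$ if $p\le Cq$ for some $C>0$, and let $\mathfrak{Norm}(V)$ be the set of classes $[p]$ of elements of $\operatorname{Norm}(V)$ under mutual domination, partially ordered by $\lesssim$; let $[p_{\min}]$ and $[p_{\max}]$ be its smallest and its largest element. Fix an $\operatorname{Ad}(K)$-invariant inner product on $\mathfrak k=\operatorname{Lie}(K)$ with orthonormal basis $Y_1,\dots,Y_m$, put $\Delta_K=-\sum_i Y_i^2$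 (which acts on $V$ diagonalizably with eigenvalues $\ge 0$), and for $s\in\mathbb{R}$ define the Sobolev norm $p_s(v)=p\big((1+\Delta_K)^{s/2}v\big)$. For $[p],[r]\in\mathfrak{Norm}(V)$ set $$d_\to([p],[r])=\inf\{s\ge 0\mid p\lesssim r_s\},\qquad d([p],[r])=\max\{d_\to([p],[r]),\,d_\to([r],[p])\},$$ and let $s(V)=\inf\{s\ge 0\mid p_{\max}\lesssim (p_{\min})_s\}$ be the Sobolev gap of $V$ (infima are taken in $[0,\infty]$). Proposition. Assume that $V$ is unitarizable and let $q$ be a unitary norm on $V$, i.e. a $G$-continuous norm induced by a scalar product for which $G$ acts unitarily on the Hilbert space $V_q$. Then $$d([q],[p_{\min}])=d([q],[p_{\max}]),$$ and in particular $$s(V)\le 2\,d([q],[p_{\max}]).$$ -/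

import Mathlib

open scoped ENNReal NNReal

universe u v

noncomputable section

attribute [local instance 100] LieRing.ofAssociativeRing

/-! ### Real reductive groups of inner type -/

/-- The Lie algebra of a closed subgroup `H` of `GL(n, ℝ)`. For closed `H` the set of all `X` with
`exp (t X) ∈ H` for all real `t` is already a Lie subalgebra of `M_n(ℝ)`, so that it coincides with
the Lie subalgebra that it generates. -/
def matrixLieAlgebra {n : ℕ} (H : Subgroup (GL (Fin n) ℝ)) :
    LieSubalgebra ℝ (Matrix (Fin n) (Fin n) ℝ) :=
  LieSubalgebra.lieSpan ℝ _
    {X | ∀ t : ℝ, ∃ h ∈ H, (h : Matrix (Fin n) (Fin n) ℝ) = NormedSpace.exp (t • X)}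

theorem matrixLieAlgebra_mono {n : ℕ} {H H' : Subgroup (GL (Fin n) ℝ)} (h : H ≤ H') :
    matrixLieAlgebra H ≤ matrixLieAlgebra H' :=
  LieSubalgebra.lieSpan_mono fun _ hX t => (hX t).imp fun _ hg => ⟨h hg.1, hg.2⟩

theorem conj_mem_matrixLieAlgebra {n : ℕ} {H : Subgroup (GL (Fin n) ℝ)} {g : GL (Fin n) ℝ}
    (hg : g ∈ H) {X : Matrix (Fin n) (Fin n) ℝ} (hX : X ∈ matrixLieAlgebra H) :
    (g : Matrix (Fin n) (Fin n) ℝ) * X * ((g⁻¹ : GL (Fin n) ℝ) : Matrix (Fin n) (Fin n) ℝ) ∈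
      matrixLieAlgebra H := by
  induction hX using LieSubalgebra.lieSpan_induction with
  | mem X hX =>
    refine LieSubalgebra.subset_lieSpan fun t => ?_
    obtain ⟨h, hh, he⟩ := hX t
    refine ⟨g * h * g⁻¹, H.mul_mem (H.mul_mem hg hh) (H.inv_mem hg), ?_⟩
    rw [← Matrix.smul_mul, ← Matrix.mul_smul, Matrix.exp_units_conj g (t • X), ← he]
    rfl
  | zero => simp
  | add X Y _ _ hX hY =>
    rw [mul_add, add_mul]
    exact add_mem hX hY
  | smul a X _ hX =>
    rw [Matrix.mul_smul, Matrix.smul_mul]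
    exact (matrixLieAlgebra H).smul_mem a hX
  | lie X Y _ _ hX hY =>
    have h := (matrixLieAlgebra H).lie_mem hX hY
    have e : ∀ A B : Matrix (Fin n) (Fin n) ℝ,
        ((g : Matrix (Fin n) (Fin n) ℝ) * A *
            ((g⁻¹ : GL (Fin n) ℝ) : Matrix (Fin n) (Fin n) ℝ)) *
          ((g : Matrix (Fin n) (Fin n) ℝ) * B *
            ((g⁻¹ : GL (Fin n) ℝ) : Matrix (Fin n) (Fin n) ℝ)) =
        (g : Matrix (Fin n) (Fin n) ℝ) * (A * B) *
            ((g⁻¹ : GL (Fin n) ℝ) : Matrix (Fin n) (Fin n) ℝ) := by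
      intro A B
      simp only [mul_assoc, Units.inv_mul_cancel_left]
    rw [Ring.lie_def, e, e, ← sub_mul, ← mul_sub, ← Ring.lie_def] at h
    exact h

/-- The structure of a real reductive group on a topological group `G` (in the sense of Wallach):
`G` is a finite covering of an open subgroup of the group `realPoints` of real points of a linear
algebraic group defined over `ℝ`, where `realPoints` is stable under transposition.
The covering is a continuous open homomorphism to `realPoints` with finite kernel. -/
structure RealReductiveGroup (G : Type u) [Group G] [TopologicalSpace G] where
  n : ℕ
  /-- the defining polynomials of the algebraic group, in the matrix entries -/
  eqs : Finset (MvPolynomial (Fin n × Fin n) ℝ)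
  complexPoints : Subgroup (GL (Fin n) ℂ)
  mem_complexPoints : ∀ g : GL (Fin n) ℂ, g ∈ complexPoints ↔ ∀ f ∈ eqs,
    MvPolynomial.aeval (fun ij : Fin n × Fin n => (g : Matrix (Fin n) (Fin n) ℂ) ij.1 ij.2) f = 0
  realPoints : Subgroup (GL (Fin n) ℝ)
  realPoints_eq : realPoints =
    complexPoints.comap (Matrix.GeneralLinearGroup.map Complex.ofRealHom)
  exists_transpose : ∀ g ∈ realPoints, ∃ h ∈ realPoints,
    (h : Matrix (Fin n) (Fin n) ℝ) = (g : Matrix (Fin n) (Fin n) ℝ).transpose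
  proj : G →* realPoints
  continuous_proj : Continuous proj
  isOpenMap_proj : IsOpenMap proj
  finite_ker : (proj.ker : Set G).Finite

namespace RealReductiveGroup

variable {G : Type u} [Group G] [TopologicalSpace G] (R : RealReductiveGroup G)

/-- The covering homomorphism, with values in `GL(n, ℝ)`. -/
def toGL : G →* GL (Fin R.n) ℝ := R.realPoints.subtype.comp R.proj

theorem toGL_mem (g : G) : R.toGL g ∈ R.realPoints := (R.proj g).2

/-- The Lie algebra `𝔤` of `G`, identified with that of its open image under the covering. -/
def lieAlgebra : LieSubalgebra ℝ (Matrix (Fin R.n) (Fin R.n) ℝ) := matrixLieAlgebra R.realPoints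

/-- The Lie algebra `𝔨` of a compact subgroup `K` of `G`. -/
def lieAlgebraOf (K : Subgroup G) : LieSubalgebra ℝ (Matrix (Fin R.n) (Fin R.n) ℝ) :=
  matrixLieAlgebra (K.map R.toGL)

theorem lieAlgebraOf_le (K : Subgroup G) : R.lieAlgebraOf K ≤ R.lieAlgebra := by
  refine matrixLieAlgebra_mono ?_
  rintro _ ⟨g, -, rfl⟩
  exact R.toGL_mem g

/-- The adjoint action of `G` on `𝔤`. -/
def Ad (g : G) (X : R.lieAlgebra) : R.lieAlgebra :=
  ⟨_, conj_mem_matrixLieAlgebra (R.toGL_mem g) X.2⟩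

/-- The adjoint action of `K` on `𝔨`. -/
def AdOf (K : Subgroup G) (k : K) (X : R.lieAlgebraOf K) : R.lieAlgebraOf K :=
  ⟨_, conj_mem_matrixLieAlgebra (Subgroup.mem_map_of_mem R.toGL k.2) X.2⟩

/-- `c` is the one-parameter subgroup `t ↦ exp (t X)` of `G`. -/
structure IsExpCurve (X : R.lieAlgebra) (c : ℝ → G) : Prop where
  continuous : Continuous c
  map_add : ∀ s t, c (s + t) = c s * c t
  toGL_eq : ∀ t, (R.toGL (c t) : Matrix (Fin R.n) (Fin R.n) ℝ) =
    NormedSpace.exp (t • (X : Matrix (Fin R.n) (Fin R.n) ℝ))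

/-- `G` is of inner type: `Ad(g)` belongs to `Int(𝔤_ℂ)` for every `g`. Here `𝔤_ℂ = 𝔤 + i𝔤` inside
`M_n(ℂ)`, and `Int(𝔤_ℂ)`, generated by the `exp (ad Z) = Ad (exp Z)` with `Z ∈ 𝔤_ℂ`, consists of
the conjugations by elements of the group generated by the `exp Z`. -/
def IsInnerType : Prop :=
  ∀ g : G, ∃ h ∈ Subgroup.closure {h : GL (Fin R.n) ℂ | ∃ A B : R.lieAlgebra,
      (h : Matrix (Fin R.n) (Fin R.n) ℂ) =
        NormedSpace.exp ((A : Matrix (Fin R.n) (Fin R.n) ℝ).map Complex.ofReal +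
          Complex.I • (B : Matrix (Fin R.n) (Fin R.n) ℝ).map Complex.ofReal)},
    ∀ X : R.lieAlgebra, (R.Ad g X : Matrix (Fin R.n) (Fin R.n) ℝ).map Complex.ofReal =
      (h : Matrix (Fin R.n) (Fin R.n) ℂ) *
        (X : Matrix (Fin R.n) (Fin R.n) ℝ).map Complex.ofReal *
        ((h⁻¹ : GL (Fin R.n) ℂ) : Matrix (Fin R.n) (Fin R.n) ℂ)

/-- A basis of `𝔨` that is orthonormal for an `Ad(K)`-invariant inner product on `𝔨`, such as the
restriction of (minus) a Cartan-Killing form of `𝔤`. -/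
structure OrthonormalBasisOf (K : Subgroup G) where
  form : LinearMap.BilinForm ℝ (R.lieAlgebraOf K)
  form_Ad : ∀ (k : K) (X X' : R.lieAlgebraOf K),
    form (R.AdOf K k X) (R.AdOf K k X') = form X X'
  dim : ℕ
  basis : Module.Basis (Fin dim) ℝ (R.lieAlgebraOf K)
  orthonormal : ∀ i j, form (basis i) (basis j) = if i = j then 1 else 0

end RealReductiveGroup

/-! ### Harish-Chandra modules -/

/-- A `(𝔤, K)`-module structure on the complex vector space `V`. -/
structure GKModule {G : Type u} [Group G] [TopologicalSpace G] (R : RealReductiveGroup G)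
    (K : Subgroup G) (V : Type v) [AddCommGroup V] [Module ℂ V] where
  gAct : R.lieAlgebra →ₗ⁅ℝ⁆ Module.End ℂ V
  kAct : Representation ℂ K V
  kAct_finite : ∀ v, FiniteDimensional ℂ (Submodule.span ℂ (Set.range fun k : K => kAct k v))
  /-- `K` acts continuously on the finite-dimensional `K`-stable subspaces -/
  kAct_continuous : ∀ (v : V) (l : V →ₗ[ℂ] ℂ), Continuous fun k : K => l (kAct k v)
  /-- the differential of the action of `K` is the restriction to `𝔨` of the action of `𝔤` -/
  kAct_deriv : ∀ (X : R.lieAlgebraOf K) (c : ℝ → K),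
    R.IsExpCurve (LieSubalgebra.inclusion (R.lieAlgebraOf_le K) X) (fun t => (c t : G)) →
    ∀ (v : V) (l : V →ₗ[ℂ] ℂ), HasDerivAt (fun t => l (kAct (c t) v))
      (l (gAct (LieSubalgebra.inclusion (R.lieAlgebraOf_le K) X) v)) 0
  kAct_gAct : ∀ (k : K) (X : R.lieAlgebra) (v : V),
    kAct k (gAct X v) = gAct (R.Ad k X) (kAct k v)

/-- The operator `(1 + T)^{s/2}` for a diagonalizable operator `T` with real eigenvalues:
it exists by the independence of eigenspaces. -/
theorem exists_besselPower {V : Type v} [AddCommGroup V] [Module ℂ V] (T : Module.End ℂ V)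
    (s : ℝ) : ∃ D : Module.End ℂ V, ∀ (μ : ℝ) (v : V), T v = (μ : ℂ) • v →
      D v = (((1 + μ) ^ (s / 2) : ℝ) : ℂ) • v := by
  have hind : iSupIndep fun μ : ℝ => Module.End.eigenspace T (μ : ℂ) :=
    (Module.End.eigenspaces_iSupIndep T).comp Complex.ofReal_injective
  obtain ⟨r, hr⟩ := LinearMap.exists_leftInverse_of_injective
    (DFinsupp.lsum ℕ fun μ : ℝ => (Module.End.eigenspace T (μ : ℂ)).subtype)
    (LinearMap.ker_eq_bot.2 hind.dfinsupp_lsum_injective)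
  refine ⟨(DFinsupp.lsum ℕ fun μ : ℝ =>
    ((((1 + μ) ^ (s / 2) : ℝ) : ℂ) • (Module.End.eigenspace T (μ : ℂ)).subtype)) ∘ₗ r, ?_⟩
  intro μ v hv
  have hr' := LinearMap.congr_fun hr
    (DFinsupp.single μ ⟨v, Module.End.mem_eigenspace_iff.2 hv⟩)
  simp only [LinearMap.comp_apply, DFinsupp.lsum_single, Submodule.subtype_apply,
    LinearMap.id_apply] at hr'
  rw [LinearMap.comp_apply, hr']
  simp

/-- The operator `(1 + T)^{s/2}`, that is multiplication by `(1 + μ)^{s/2}` on the `μ`-eigenspace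
of `T` (this determines it if the eigenspaces of `T` to real eigenvalues span `V`). -/
def besselPower {V : Type v} [AddCommGroup V] [Module ℂ V] (T : Module.End ℂ V) (s : ℝ) :
    Module.End ℂ V :=
  Classical.choose (exists_besselPower T s)

theorem besselPower_apply {V : Type v} [AddCommGroup V] [Module ℂ V] (T : Module.End ℂ V) (s : ℝ)
    (μ : ℝ) (v : V) (hv : T v = (μ : ℂ) • v) :
    besselPower T s v = (((1 + μ) ^ (s / 2) : ℝ) : ℂ) • v :=
  Classical.choose_spec (exists_besselPower T s) μ v hv

namespace GKModule

variable {G : Type u} [Group G] [TopologicalSpace G] {R : RealReductiveGroup G}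
  {K : Subgroup G} {V : Type v} [AddCommGroup V] [Module ℂ V] (M : GKModule R K V)

/-- A Harish-Chandra module is a finitely generated (over `U(𝔤)`) and `K`-admissible
`(𝔤, K)`-module: `Hom_K(τ, V)` is finite-dimensional for each irreducible continuous (hence
finite-dimensional) representation `τ` of the compact group `K`. -/
structure IsHarishChandra : Prop where
  finitelyGenerated : ∃ S : Finset V, ∀ W : Submodule ℂ V, (∀ v ∈ S, v ∈ W) →
    (∀ (X : R.lieAlgebra), ∀ w ∈ W, M.gAct X w ∈ W) → W = ⊤
  admissible : ∀ (d : ℕ) (τ : Representation ℂ K (Fin d → ℂ)), τ.IsIrreducible →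
    (∀ w, Continuous fun k : K => τ k w) →
    FiniteDimensional ℂ (Representation.IntertwiningMap τ M.kAct)

/-! ### `G`-continuous norms -/

/-- A continuous representation of `G` on the completion `E = V_p` of `V` for the norm `p`, whose
`(𝔤, K)`-module of `K`-finite vectors is `V`. -/
structure Globalization (p : Seminorm ℂ V) where
  E : Type v
  [normedAddCommGroup : NormedAddCommGroup E]
  [normedSpace : NormedSpace ℂ E]
  [completeSpace : CompleteSpace E]
  ι : V →ₗ[ℂ] E
  norm_ι : ∀ v, ‖ι v‖ = p v
  denseRange_ι : DenseRange ι
  π : G →* (E →L[ℂ] E)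
  continuous_π : Continuous fun x : G × E => π x.1 x.2
  kFinite_iff : ∀ x : E,
    FiniteDimensional ℂ (Submodule.span ℂ (Set.range fun k : K => π k x)) ↔ x ∈ Set.range ι
  π_ι : ∀ (k : K) (v : V), π k (ι v) = ι (M.kAct k v)
  hasDerivAt_π_ι : ∀ (X : R.lieAlgebra) (c : ℝ → G), R.IsExpCurve X c → ∀ v : V,
    HasDerivAt (fun t => π (c t) (ι v)) (ι (M.gAct X v)) 0

attribute [instance] Globalization.normedAddCommGroup Globalization.normedSpace
  Globalization.completeSpace

/-- `Norm(V)`: the `G`-continuous norms on `V` of uniformly bounded growth,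
`p (g · v) ≤ C p v` for all `g ∈ G` and `v ∈ V`. -/
structure BoundedNorm where
  toSeminorm : Seminorm ℂ V
  eq_zero : ∀ v, toSeminorm v = 0 → v = 0
  exists_globalization : ∃ (B : M.Globalization toSeminorm) (C : ℝ), 0 < C ∧
    ∀ (g : G) (v : V), ‖B.π g (B.ι v)‖ ≤ C * toSeminorm v

/-- `p ≲ q`: `p` is dominated by a multiple of `q`. -/
def Dominated (p q : Seminorm ℂ V) : Prop := ∃ C : ℝ, 0 < C ∧ ∀ v, p v ≤ C * q v

theorem Dominated.refl (p : Seminorm ℂ V) : Dominated p p := ⟨1, one_pos, fun v => by simp⟩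

theorem Dominated.trans {p q r : Seminorm ℂ V} (h : Dominated p q) (h' : Dominated q r) :
    Dominated p r := by
  obtain ⟨C, hC, h⟩ := h
  obtain ⟨C', hC', h'⟩ := h'
  refine ⟨C * C', mul_pos hC hC', fun v => (h v).trans ?_⟩
  rw [mul_assoc]
  exact mul_le_mul_of_nonneg_left (h' v) hC.le

/-- `Norm(V)` is preordered by domination. -/
instance : Preorder M.BoundedNorm where
  le p q := Dominated p.toSeminorm q.toSeminorm
  le_refl p := Dominated.refl _
  le_trans _ _ _ h h' := Dominated.trans h h'

/-- The set of equivalence classes `[p]` of norms in `Norm(V)`, partially ordered by domination. -/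
abbrev NormClass : Type v := Antisymmetrization M.BoundedNorm (· ≤ ·)

variable {M} in
/-- The class `[p]` of `p`. -/
def BoundedNorm.cls (p : M.BoundedNorm) : M.NormClass := toAntisymmetrization (· ≤ ·) p

variable {M} in
/-- `q` is a unitary norm: it comes from a scalar product on `V`, and `G` acts isometrically, hence
unitarily, on the Hilbert space `V_q`. -/
def BoundedNorm.IsUnitary (q : M.BoundedNorm) : Prop :=
  (∃ c : InnerProductSpace.Core ℂ V, ∀ v, q.toSeminorm v ^ 2 = (c.inner v v).re) ∧
    ∃ B : M.Globalization q.toSeminorm, ∀ (g : G) (x : B.E), ‖B.π g x‖ = ‖x‖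

/-! ### Sobolev norms, the pseudometric and the Sobolev gap -/

/-- The Laplacian `Δ_K = -∑ Y_i²` of `K`, acting on `V`. -/
def laplacian (Y : R.OrthonormalBasisOf K) : Module.End ℂ V :=
  -∑ i, M.gAct (LieSubalgebra.inclusion (R.lieAlgebraOf_le K) (Y.basis i)) *
    M.gAct (LieSubalgebra.inclusion (R.lieAlgebraOf_le K) (Y.basis i))

/-- The Sobolev norm `p_s = p ∘ (1 + Δ_K)^{s/2}`. -/
def sobolev (Y : R.OrthonormalBasisOf K) (p : Seminorm ℂ V) (s : ℝ) : Seminorm ℂ V :=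
  p.comp (besselPower (M.laplacian Y) s)

theorem sobolev_mono (Y : R.OrthonormalBasisOf K) {p q : Seminorm ℂ V} (h : Dominated p q)
    (s : ℝ) : Dominated (M.sobolev Y p s) (M.sobolev Y q s) :=
  h.imp fun _ hC => ⟨hC.1, fun _ => hC.2 _⟩

/-- `d_→(p, q) = inf {s ≥ 0 | p ≲ q_s}`, with values in `[0, ∞]`. -/
def dArrowNorm (Y : R.OrthonormalBasisOf K) (p q : M.BoundedNorm) : ℝ≥0∞ :=
  ⨅ (s : ℝ≥0) (_ : Dominated p.toSeminorm (M.sobolev Y q.toSeminorm s)), (s : ℝ≥0∞)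

theorem dArrowNorm_le (Y : R.OrthonormalBasisOf K) {p p' q q' : M.BoundedNorm} (hp : p' ≤ p)
    (hq : q ≤ q') : M.dArrowNorm Y p' q' ≤ M.dArrowNorm Y p q :=
  iInf_mono fun s => iInf_mono' fun h =>
    ⟨Dominated.trans hp (Dominated.trans h (M.sobolev_mono Y hq s)), le_rfl⟩

/-- `d_→([p], [q])`, well defined on classes. -/
def dArrow (Y : R.OrthonormalBasisOf K) : M.NormClass → M.NormClass → ℝ≥0∞ :=
  Quotient.lift₂ (M.dArrowNorm Y) fun _ _ _ _ hp hq =>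
    le_antisymm (M.dArrowNorm_le Y hp.1 hq.2) (M.dArrowNorm_le Y hp.2 hq.1)

/-- The pseudometric `d([p], [q]) = max (d_→([p], [q])) (d_→([q], [p]))`. -/
def d (Y : R.OrthonormalBasisOf K) (a b : M.NormClass) : ℝ≥0∞ :=
  max (M.dArrow Y a b) (M.dArrow Y b a)

/-- The Sobolev gap `s(V) = inf {s ≥ 0 | p_max ≲ p_{min,s}}`, where `p_min` and `p_max` represent
the smallest and the largest class of norms in `Norm(V)`. -/
def sobolevGap (Y : R.OrthonormalBasisOf K) : ℝ≥0∞ :=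
  ⨅ (s : ℝ≥0) (_ : ∃ pmin pmax : M.BoundedNorm, IsBot pmin.cls ∧ IsTop pmax.cls ∧
    Dominated pmax.toSeminorm (M.sobolev Y pmin.toSeminorm s)), (s : ℝ≥0∞)

end GKModule

end

/-! A unitary norm `q` makes `V` a pre-Hilbert space, and every `p` in `Norm(V)` acquires a dual
norm `p'(w) = sup |⟨v, w⟩| / p(v)` over nonzero `v`. Duality reverses domination, fixes `q` and is
involutive up to equivalence, so it interchanges `p_min` and `p_max`. The Laplacian is symmetric,
hence its Bessel powers move across the scalar product, and `q ≲ (p_min)_s` holds exactly when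
`p_max ≲ q_s` (`dominated_sobolev_of_dominated_sobolev_bot` and its converse). So `d_→(q, p_min) =
d_→(p_max, q)`, while the opposite directed distances vanish; chaining the two dominations gives
`p_max ≲ (p_min)_{2s}`, which bounds the gap.

The work lies in `BoundedNorm.exists_dual`: `p'` is again in `Norm(V)`, and `p''` is equivalent to
`p`. The functionals `⟨·, w⟩` must be bounded for `p`, and on their closure in the conjugate dual of
`V_p` the group must act continuously, with the right derivative and the right `K`-finite vectors.
Conjugate linear functionals are used so that `w ↦ ⟨·, w⟩` is linear.

One device recurs. Averaging a functional over `K` against a left finite function gives a `K`-finite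
functional, which by admissibility is `⟨·, w⟩` for some `w` in `V` (`exists_average_eq_inner`). On
the other hand, a continuous function on `K` that factors through the action on `V` and is
orthogonal to all left finite functions is zero (`IsAdmissibleUnitary.eq_zero_of_forall_integral`),
by Stone-Weierstrass, because the matrix coefficients of `V` are left finite. Facts known for
averages, hence for vectors of `V`, thus extend to single functionals and to `G`-translates of
vectors. -/

open MeasureTheory Topology

noncomputable section

attribute [local instance 100] LieRing.ofAssociativeRing

/-! ### Stone-Weierstrass for algebras that need not separate points. -/

section StoneWeierstrass

/-- A version of the Stone-Weierstrass theorem without separation of points: a star subalgebra of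
`C(X, ℂ)` is dense in the functions that are constant on the classes of points it does not
separate. -/
theorem StarSubalgebra.mem_topologicalClosure_of_not_separated {X : Type*} [TopologicalSpace X]
    [CompactSpace X] (A : StarSubalgebra ℂ C(X, ℂ)) (φ : C(X, ℂ))
    (hφ : ∀ x y, (∀ a ∈ A, a x = a y) → φ x = φ y) : φ ∈ A.topologicalClosure := by
  -- On the quotient by this relation the algebra does separate points, so the usual theorem applies
  -- there; pulling back along the projection is continuous.
  let s : Setoid X := ⟨fun x y => ∀ a ∈ A, a x = a y, fun _ _ _ => rfl,
    fun h a ha => (h a ha).symm, fun h h' a ha => (h a ha).trans (h' a ha)⟩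
  let pr : C(X, Quotient s) := ⟨Quotient.mk s, continuous_quotient_mk'⟩
  let Φ : C(Quotient s, ℂ) →⋆ₐ[ℂ] C(X, ℂ) := ContinuousMap.compStarAlgHom' ℂ ℂ pr
  have hΦ : Continuous Φ := ContinuousMap.continuous_precomp pr
  let A' : StarSubalgebra ℂ C(Quotient s, ℂ) := A.comap Φ
  have hsep : A'.SeparatesPoints := by
    intro x y hxy
    induction x using Quotient.inductionOn with | _ x
    induction y using Quotient.inductionOn with | _ y
    have : ¬ ∀ a ∈ A, a x = a y := fun h => hxy (Quotient.sound h)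
    push Not at this
    obtain ⟨a, ha, hne⟩ := this
    let a' : C(Quotient s, ℂ) :=
      ⟨Quotient.lift a fun x y (h : ∀ a ∈ A, a x = a y) => h a ha, a.continuous.quotient_lift _⟩
    have ha' : Φ a' = a := by ext z; rfl
    refine ⟨a', ⟨a', ?_, rfl⟩, hne⟩
    change Φ a' ∈ A
    rwa [ha']
  have htop := ContinuousMap.starSubalgebra_topologicalClosure_eq_top_of_separatesPoints A' hsep
  let φ' : C(Quotient s, ℂ) := ⟨Quotient.lift φ hφ, φ.continuous.quotient_lift _⟩
  have h1 : φ' ∈ closure (A' : Set C(Quotient s, ℂ)) := by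
    have : φ' ∈ A'.topologicalClosure := htop ▸ trivial
    exact this
  have h2 : Φ φ' ∈ closure (A : Set C(X, ℂ)) :=
    closure_mono (Set.image_subset_iff.2 fun _ h => h)
      (image_closure_subset_closure_image hΦ ⟨_, h1, rfl⟩)
  exact h2

end StoneWeierstrass

/-! ### Left finite functions on a compact group. -/

section LeftFinite

variable (K : Type*) [Group K] [TopologicalSpace K] [IsTopologicalGroup K]

/-- Left translation of continuous functions. -/
def leftTranslate {K : Type*} [Group K] [TopologicalSpace K] [IsTopologicalGroup K] (k : K) :
    C(K, ℂ) →⋆ₐ[ℂ] C(K, ℂ) :=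
  ContinuousMap.compStarAlgHom' ℂ ℂ (ContinuousMap.mulLeft k)

@[simp] theorem leftTranslate_apply {K : Type*} [Group K] [TopologicalSpace K]
    [IsTopologicalGroup K] (k x : K) (f : C(K, ℂ)) : leftTranslate k f x = f (k * x) := rfl

/-- The star algebra of the continuous functions whose left translates span a finite-dimensional
space. -/
def leftFinite : StarSubalgebra ℂ C(K, ℂ) where
  carrier := {f | ∃ W : Submodule ℂ C(K, ℂ), W.FG ∧ f ∈ W ∧
    ∀ (k : K), ∀ b ∈ W, leftTranslate k b ∈ W}
  mul_mem' := by
    rintro f g ⟨W, hW, hf, hWk⟩ ⟨W', hW', hg, hWk'⟩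
    refine ⟨W * W', hW.mul hW', Submodule.mul_mem_mul hf hg, fun k b hb => ?_⟩
    induction hb using Submodule.mul_induction_on' with
    | mem_mul_mem x hx y hy =>
      rw [map_mul]; exact Submodule.mul_mem_mul (hWk k x hx) (hWk' k y hy)
    | add x _ y _ hx hy => rw [map_add]; exact add_mem hx hy
  add_mem' := by
    rintro f g ⟨W, hW, hf, hWk⟩ ⟨W', hW', hg, hWk'⟩
    refine ⟨W ⊔ W', hW.sup hW', add_mem (Submodule.mem_sup_left hf) (Submodule.mem_sup_right hg),
      fun k b hb => ?_⟩
    obtain ⟨x, hx, y, hy, rfl⟩ := Submodule.mem_sup.1 hb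
    rw [map_add]
    exact add_mem (Submodule.mem_sup_left (hWk k x hx)) (Submodule.mem_sup_right (hWk' k y hy))
  algebraMap_mem' := by
    intro r
    refine ⟨Submodule.span ℂ {1}, Submodule.fg_span_singleton _, ?_, fun k b hb => ?_⟩
    · rw [Algebra.algebraMap_eq_smul_one]
      exact Submodule.smul_mem _ _ (Submodule.mem_span_singleton_self _)
    · obtain ⟨c, rfl⟩ := Submodule.mem_span_singleton.1 hb
      rw [map_smul, map_one]
      exact Submodule.smul_mem _ _ (Submodule.mem_span_singleton_self _)
  star_mem' := by
    rintro f ⟨W, hW, hf, hWk⟩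
    refine ⟨W.map (starLinearEquiv ℂ : C(K, ℂ) ≃ₗ⋆[ℂ] C(K, ℂ)).toLinearMap, hW.map _,
      ⟨f, hf, rfl⟩, ?_⟩
    rintro k _ ⟨b, hb, rfl⟩
    exact ⟨_, hWk k b hb, by ext; rfl⟩

variable {K}

theorem integrable_of_continuous {X : Type*} [TopologicalSpace X] [CompactSpace X]
    [MeasurableSpace X] [BorelSpace X] (μ : Measure X) [IsFiniteMeasure μ] {E : Type*}
    [NormedAddCommGroup E] {f : X → E} (hf : Continuous f) : Integrable f μ :=
  hf.integrable_of_hasCompactSupport (HasCompactSupport.of_compactSpace f)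

/-- A continuous function that is orthogonal to a star subalgebra and constant on the
classes of points not separated by it vanishes. -/
theorem eq_zero_of_forall_integral_mul_eq_zero {K : Type*} [TopologicalSpace K] [CompactSpace K]
    [MeasurableSpace K] [BorelSpace K] (μ : Measure K) [IsFiniteMeasure μ] [μ.IsOpenPosMeasure]
    (A : StarSubalgebra ℂ C(K, ℂ)) (φ : K → ℂ)
    (hc : Continuous φ) (hφ : ∀ x y, (∀ a ∈ A, a x = a y) → φ x = φ y)
    (h : ∀ a ∈ A, ∫ k, a k * φ k ∂μ = 0) (k : K) : φ k = 0 := by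
  let φ' : C(K, ℂ) := ⟨φ, hc⟩
  -- The conjugate of `φ` is a uniform limit of elements of `A`, so `φ` is orthogonal to it as well,
  -- which means `∫ |φ|² = 0`.
  have hmem := A.mem_topologicalClosure_of_not_separated (star φ') fun x y hxy => by
    simp [φ', hφ x y hxy]
  let I : C(K, ℂ) →L[ℂ] ℂ := LinearMap.mkContinuous
    { toFun := fun a => ∫ k, a k * φ k ∂μ
      map_add' := fun a b => by
        rw [← integral_add (integrable_of_continuous μ (by fun_prop))
          (integrable_of_continuous μ (by fun_prop))]
        simp [add_mul]
      map_smul' := fun c a => by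
        rw [RingHom.id_apply, smul_eq_mul, ← integral_const_mul]
        simp [mul_assoc] }
    (‖φ'‖ * μ.real Set.univ) fun a => by
      have := norm_integral_le_of_norm_le_const (μ := μ) (f := fun k => a k * φ k)
        (C := ‖a‖ * ‖φ'‖) (.of_forall fun k => by
          rw [norm_mul]
          exact mul_le_mul (a.norm_coe_le_norm k) (φ'.norm_coe_le_norm k) (norm_nonneg _)
            (norm_nonneg _))
      simp only [LinearMap.coe_mk, AddHom.coe_mk]
      linarith
  have h0 : I (star φ') = 0 := by
    have : closure (A : Set C(K, ℂ)) ⊆ {a | I a = 0} :=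
      closure_minimal h (isClosed_eq I.continuous continuous_const)
    exact this hmem
  have h1 : ∫ k, ‖φ k‖ ^ 2 ∂μ = 0 := by
    have : I (star φ') = ((∫ k, ‖φ k‖ ^ 2 ∂μ : ℝ) : ℂ) := by
      rw [← integral_complex_ofReal]
      refine integral_congr_ae (.of_forall fun k => ?_)
      have := RCLike.conj_mul (φ k)
      simpa [φ'] using this
    rw [h0] at this
    exact_mod_cast this.symm
  by_contra hk
  have hcont : Continuous fun k => ‖φ k‖ ^ 2 := by fun_prop
  have := hcont.integral_pos_of_hasCompactSupport_nonneg_nonzero (μ := μ) (x := k)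
    (HasCompactSupport.of_compactSpace _) (fun k => by positivity) (by simpa using hk)
  exact this.ne' h1

end LeftFinite

/-! ### Finiteness of spaces of intertwining maps. -/

section HomK

variable {K : Type*} [Group K] {Q V : Type*} [AddCommGroup Q] [Module ℂ Q] [AddCommGroup V]
  [Module ℂ V]

/-- The space of intertwining maps, as a space of linear maps. -/
def homK (τ : Representation ℂ K Q) (ρ : Representation ℂ K V) : Submodule ℂ (Q →ₗ[ℂ] V) where
  carrier := {S | ∀ k w, S (τ k w) = ρ k (S w)}
  add_mem' h h' k w := by simp [h k w, h' k w]
  zero_mem' k w := by simp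
  smul_mem' c S h k w := by simp [h k w]

theorem homK_fg_of_finiteDimensional (τ : Representation ℂ K Q) (ρ : Representation ℂ K V)
    [FiniteDimensional ℂ (Representation.IntertwiningMap τ ρ)] : (homK τ ρ).FG := by
  let Φ : Representation.IntertwiningMap τ ρ →ₗ[ℂ] (Q →ₗ[ℂ] V) :=
    { toFun := fun f => f.toLinearMap
      map_add' := fun _ _ => rfl
      map_smul' := fun _ _ => rfl }
  refine Submodule.FG.of_le (Module.Finite.fg_top.map Φ) fun S hS => ?_
  exact ⟨LinearMap.intertwiningMap_of_isIntertwiningMap τ ρ S hS, trivial, rfl⟩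

/-- Weak continuity of a representation. -/
def WeaklyContinuous [TopologicalSpace K] (τ : Representation ℂ K Q) : Prop :=
  ∀ (w : Q) (l : Q →ₗ[ℂ] ℂ), Continuous fun k => l (τ k w)

variable [TopologicalSpace K]

/-- Finite multiplicities of the irreducible representations. -/
def FiniteMultiplicities (ρ : Representation ℂ K V) : Prop :=
  ∀ (d : ℕ) (τ : Representation ℂ K (Fin d → ℂ)), τ.IsIrreducible → WeaklyContinuous τ →
    (homK τ ρ).FG

/-- Induction on the dimension of `Q`. For a proper nonzero stable `W`, restriction to `W` maps the
intertwiners into those on `W`, with kernel the intertwiners on `Q ⧸ W`. Without such a `W` the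
representation is irreducible or zero. -/
theorem FiniteMultiplicities.homK_fg {ρ : Representation ℂ K V} (hρ : FiniteMultiplicities ρ)
    [FiniteDimensional ℂ Q] (τ : Representation ℂ K Q) (hτ : WeaklyContinuous τ) :
    (homK τ ρ).FG := by
  induction hn : Module.finrank ℂ Q using Nat.strong_induction_on generalizing Q with
  | _ n ih
  by_cases hW : ∃ W : Submodule ℂ Q, (∀ k, W ≤ W.comap (τ k)) ∧ W ≠ ⊥ ∧ W ≠ ⊤
  · obtain ⟨W, hWk, hbot, htop⟩ := hW
    let τ₁ : Representation ℂ K W := Subrepresentation.toRepresentation (ρ := τ)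
      ⟨W, fun k _ h => hWk k h⟩
    let τ₂ : Representation ℂ K (Q ⧸ W) := τ.quotient W hWk
    have h1 : (homK τ₁ ρ).FG := by
      refine ih _ (hn ▸ Submodule.finrank_lt htop) τ₁ (fun w l => ?_) rfl
      obtain ⟨l', hl'⟩ := l.exists_extend
      have := hτ w l'
      rw [← hl']
      exact this
    have h2 : (homK τ₂ ρ).FG := by
      refine ih _ ?_ τ₂ (fun w l => ?_) rfl
      · have := Submodule.finrank_quotient_add_finrank W
        have := Submodule.one_le_finrank_iff.2 hbot
        omega
      · obtain ⟨w, rfl⟩ := W.mkQ_surjective w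
        exact hτ w (l ∘ₗ W.mkQ)
    refine Submodule.fg_of_fg_map_of_fg_inf_ker (LinearMap.lcomp ℂ V W.subtype) ?_ ?_
    · refine Submodule.FG.of_le h1 ?_
      rintro _ ⟨S, hS, rfl⟩ k w
      exact hS k w
    · refine Submodule.FG.of_le (h2.map (LinearMap.lcomp ℂ V W.mkQ)) ?_
      rintro S ⟨hS, hS'⟩
      have hker : W ≤ LinearMap.ker S := fun w hw => LinearMap.congr_fun hS' ⟨w, hw⟩
      refine ⟨W.liftQ S hker, fun k w => ?_, by ext; rfl⟩
      obtain ⟨w, rfl⟩ := W.mkQ_surjective w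
      exact hS k w
  · push Not at hW
    let e : Q ≃ₗ[ℂ] (Fin n → ℂ) := LinearEquiv.ofFinrankEq _ _ (by simp [hn])
    by_cases h0 : n = 0
    · have : Subsingleton Q := Module.finrank_zero_iff.1 (hn.trans h0)
      have : Subsingleton (Q →ₗ[ℂ] V) := ⟨fun f g => LinearMap.ext fun x => by
        rw [Subsingleton.elim x 0, map_zero, map_zero]⟩
      rw [Subsingleton.elim (homK τ ρ) ⊥]
      exact Submodule.fg_bot
    let τ' : Representation ℂ K (Fin n → ℂ) :=
      { toFun := fun k => e.toLinearMap ∘ₗ τ k ∘ₗ e.symm.toLinearMap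
        map_one' := by ext; simp
        map_mul' := fun a b => by ext; simp }
    have hirr : τ'.IsIrreducible := by
      have : Nonempty (Fin n) := ⟨⟨0, Nat.pos_of_ne_zero h0⟩⟩
      have hbt : (⊥ : Subrepresentation τ') ≠ ⊤ := fun h =>
        bot_ne_top (α := Submodule ℂ (Fin n → ℂ)) (congrArg Subrepresentation.toSubmodule h)
      refine { exists_pair_ne := ⟨⊥, ⊤, hbt⟩, eq_bot_or_eq_top := fun U => ?_ }
      have hU : ∀ k, U.toSubmodule.comap e.toLinearMap ≤
          (U.toSubmodule.comap e.toLinearMap).comap (τ k) := fun k w hw => by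
        have := U.apply_mem_toSubmodule k hw
        simpa [τ'] using this
      have key := hW _ hU
      by_cases hb : U.toSubmodule.comap e.toLinearMap = ⊥
      · left
        apply Subrepresentation.toSubmodule_injective
        refine (Submodule.eq_bot_iff _).2 fun x hx => ?_
        have : e.symm x ∈ U.toSubmodule.comap e.toLinearMap := by simpa using hx
        rw [hb] at this
        simpa using this
      · right
        apply Subrepresentation.toSubmodule_injective
        refine (Submodule.eq_top_iff' (p := U.toSubmodule)).2 fun x => ?_
        have : e.symm x ∈ U.toSubmodule.comap e.toLinearMap := key hb ▸ trivial
        simpa using this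
    have := hρ n τ' hirr fun w l => hτ (e.symm w) (l ∘ₗ e.toLinearMap)
    refine Submodule.FG.of_le (this.map (LinearMap.lcomp ℂ V e.toLinearMap)) fun S hS => ?_
    refine ⟨S ∘ₗ e.symm.toLinearMap, fun k w => ?_, by ext; simp⟩
    simpa [τ'] using hS k (e.symm w)

end HomK

/-! ### Subspaces of admissible unitary representations; `V` is not assumed complete. -/

section Unitary

variable {K : Type*} [Group K] [TopologicalSpace K] {V : Type*} [NormedAddCommGroup V]
  [InnerProductSpace ℂ V]

/-- A locally finite, weakly continuous and unitary representation with finite multiplicities. -/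
structure IsAdmissibleUnitary (ρ : Representation ℂ K V) : Prop where
  inner_map : ∀ k v w, inner ℂ (ρ k v) (ρ k w) = inner ℂ v w
  locallyFinite : ∀ v, ∃ U : Submodule ℂ V, U.FG ∧ v ∈ U ∧ ∀ k, U ≤ U.comap (ρ k)
  weaklyContinuous : WeaklyContinuous ρ
  finiteMultiplicities : FiniteMultiplicities ρ

namespace IsAdmissibleUnitary

variable {ρ : Representation ℂ K V} (h : IsAdmissibleUnitary ρ)
include h

theorem inner_map_left (k : K) (v w : V) : inner ℂ (ρ k v) w = inner ℂ v (ρ k⁻¹ w) := by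
  rw [← h.inner_map k v, ← Module.End.mul_apply, ← map_mul, mul_inv_cancel, map_one,
    Module.End.one_apply]

theorem orthogonal_le_comap {N : Submodule ℂ V} (hN : ∀ k, N ≤ N.comap (ρ k)) (k : K) :
    Nᗮ ≤ Nᗮ.comap (ρ k) := fun v hv u hu => by
  have := h.inner_map_left k⁻¹ u v
  rw [inv_inv] at this
  rw [← this]
  exact hv _ (hN _ hu)

theorem exists_fg_of_finset (s : Set V) (hs : s.Finite) :
    ∃ U : Submodule ℂ V, U.FG ∧ s ⊆ U ∧ ∀ k, U ≤ U.comap (ρ k) := by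
  induction s, hs using Set.Finite.induction_on with
  | empty => exact ⟨⊥, Submodule.fg_bot, by simp, fun k => bot_le⟩
  | @insert a s _ _ ih =>
    obtain ⟨U, hU, hs, hk⟩ := ih
    obtain ⟨U', hU', ha, hk'⟩ := h.locallyFinite a
    refine ⟨U' ⊔ U, hU'.sup hU, ?_, fun k => sup_le ?_ ?_⟩
    · exact Set.insert_subset (Submodule.mem_sup_left ha)
        (hs.trans fun x hx => Submodule.mem_sup_right hx)
    · exact (hk' k).trans (Submodule.comap_mono le_sup_left)
    · exact (hk k).trans (Submodule.comap_mono le_sup_right)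

/-- A stable subspace of finite codimension contains the orthogonal complement of a
finite-dimensional subspace. -/
theorem exists_orthogonal_le {N : Submodule ℂ V} (hN : ∀ k, N ≤ N.comap (ρ k))
    [FiniteDimensional ℂ (V ⧸ N)] : ∃ F : Submodule ℂ V, F.FG ∧ Fᗮ ≤ N := by
  have hτ : WeaklyContinuous (ρ.quotient N hN) := fun w l => by
    obtain ⟨w, rfl⟩ := N.mkQ_surjective w
    exact h.weaklyContinuous w (l ∘ₗ N.mkQ)
  have hfg := h.finiteMultiplicities.homK_fg (ρ.quotient N hN) hτ
  obtain ⟨T, hT⟩ := hfg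
  -- The sum of the images of all intertwiners `V ⧸ N → V`; it is finite-dimensional because
  -- finitely many intertwiners span them all.
  let F : Submodule ℂ V := ⨆ S ∈ T, LinearMap.range S
  have hF : ∀ S ∈ homK (ρ.quotient N hN) ρ, LinearMap.range S ≤ F := by
    intro S hS
    rw [← hT] at hS
    induction hS using Submodule.span_induction with
    | mem S hS => exact le_iSup₂ (f := fun S (_ : S ∈ T) => LinearMap.range S) S hS
    | zero => simp
    | add S S' _ _ h h' =>
      rintro _ ⟨x, rfl⟩
      exact F.add_mem (h ⟨x, rfl⟩) (h' ⟨x, rfl⟩)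
    | smul c S _ h =>
      rintro _ ⟨x, rfl⟩
      exact F.smul_mem _ (h ⟨x, rfl⟩)
  refine ⟨F, Submodule.fg_biSup _ _ fun S _ => ?_, fun v hv => ?_⟩
  · exact LinearMap.range_eq_map S ▸ (Module.Finite.fg_top (R := ℂ) (M := V ⧸ N)).map S
  -- a stable finite-dimensional subspace that contains `v` and maps onto `V / N`
  obtain ⟨t, ht, htspan⟩ := (Submodule.fg_def).1 (Module.Finite.fg_top (R := ℂ) (M := V ⧸ N))
  obtain ⟨U, hU, hsub, hUk⟩ := h.exists_fg_of_finset
    (insert v (Function.surjInv N.mkQ_surjective '' t))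
    ((ht.image _).insert _)
  have hUN : U.map N.mkQ = ⊤ := by
    rw [eq_top_iff, ← htspan, Submodule.span_le]
    intro x hx
    exact ⟨_, hsub (Set.mem_insert_of_mem _ ⟨x, hx, rfl⟩), Function.surjInv_eq _ x⟩
  have : FiniteDimensional ℂ (U ⊓ N : Submodule ℂ V) := .of_fg (Submodule.FG.of_le hU inf_le_left)
  have hUNk : ∀ k, U ⊓ N ≤ (U ⊓ N).comap (ρ k) := fun k x hx => ⟨hUk k hx.1, hN k hx.2⟩
  let U₁ : Submodule ℂ V := U ⊓ (U ⊓ N)ᗮ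
  have hU₁k : ∀ k, U₁ ≤ U₁.comap (ρ k) := fun k x hx =>
    ⟨hUk k hx.1, h.orthogonal_le_comap hUNk k hx.2⟩
  have hdecomp : ∀ x ∈ U, ∃ y ∈ U ⊓ N, ∃ z ∈ U₁, y + z = x := by
    intro x hx
    obtain ⟨y, hy, z, hz, rfl⟩ := (U ⊓ N).exists_add_mem_mem_orthogonal x
    refine ⟨y, hy, z, ⟨?_, hz⟩, rfl⟩
    simpa using U.sub_mem hx hy.1
  let f : U₁ →ₗ[ℂ] V ⧸ N := N.mkQ ∘ₗ U₁.subtype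
  have hf : Function.Bijective f := by
    constructor
    · refine (injective_iff_map_eq_zero f).2 fun x hx => ?_
      have hxN : (x : V) ∈ N := (Submodule.Quotient.mk_eq_zero N).1 hx
      have := x.2.2 x ⟨x.2.1, hxN⟩
      exact Subtype.ext (inner_self_eq_zero.1 this)
    · intro q
      obtain ⟨x, hx, rfl⟩ : q ∈ U.map N.mkQ := hUN ▸ trivial
      obtain ⟨y, hy, z, hz, rfl⟩ := hdecomp x hx
      refine ⟨⟨z, hz⟩, ?_⟩
      have : N.mkQ y = 0 := (Submodule.Quotient.mk_eq_zero N).2 hy.2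
      rw [map_add, this, zero_add]
      rfl
  let e := LinearEquiv.ofBijective f hf
  -- `U₁` is a copy of `V ⧸ N` inside `V`, hence contained in `F`. If `v` is orthogonal to `F`, its
  -- component in `U₁` is therefore orthogonal to itself, and `v` lies in `N`.
  have hS : U₁.subtype ∘ₗ e.symm.toLinearMap ∈ homK (ρ.quotient N hN) ρ := by
    intro k w
    obtain ⟨x, rfl⟩ := e.surjective w
    have : (ρ.quotient N hN) k (e x) = e ⟨ρ k x, hU₁k k x.2⟩ := rfl
    rw [this]
    simp
  obtain ⟨y, hy, z, hz, rfl⟩ := hdecomp v (hsub (Set.mem_insert _ _))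
  have hzF : z ∈ F := hF _ hS ⟨e ⟨z, hz⟩, by simp⟩
  have h1 := hv z hzF
  rw [inner_add_right, inner_eq_zero_symm.1 (hz.2 y hy), zero_add] at h1
  rw [inner_self_eq_zero.1 h1, add_zero]
  exact hy.2

/-- A conjugate linear functional that vanishes on a stable subspace of finite codimension is given
by a vector. -/
theorem exists_eq_inner {N : Submodule ℂ V} (hN : ∀ k, N ≤ N.comap (ρ k))
    [FiniteDimensional ℂ (V ⧸ N)] (η : V →ₗ⋆[ℂ] ℂ) (hη : ∀ v ∈ N, η v = 0) :
    ∃ w, ∀ v, η v = inner ℂ v w := by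
  obtain ⟨F, hF, hFN⟩ := h.exists_orthogonal_le hN
  have : FiniteDimensional ℂ F := .of_fg hF
  let b := stdOrthonormalBasis ℂ F
  -- The Riesz vector of the restriction of `η` to `F`; on the complement of `F` both sides vanish.
  refine ⟨∑ i, η (b i) • (b i : V), fun v => ?_⟩
  obtain ⟨y, hy, z, hz, rfl⟩ := F.exists_add_mem_mem_orthogonal v
  have h1 : ∀ i, inner ℂ z (b i : V) = 0 := fun i => inner_eq_zero_symm.1 (hz _ (b i).2)
  have h2 := congrArg Subtype.val (b.sum_repr ⟨y, hy⟩)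
  simp only [Submodule.coe_sum, Submodule.coe_smul] at h2
  rw [map_add, hη z (hFN hz), add_zero]
  conv_lhs => rw [← h2]
  simp only [inner_sum, inner_add_left, inner_smul_right, h1, add_zero, map_sum,
    LinearMap.map_smulₛₗ,
    b.repr_apply_apply, Submodule.coe_inner, inner_conj_symm, smul_eq_mul]
  exact Finset.sum_congr rfl fun i _ => mul_comm _ _

omit h in
theorem restrict (h : IsAdmissibleUnitary ρ) (W : Submodule ℂ V) (hW : ∀ k, W ≤ W.comap (ρ k)) :
    IsAdmissibleUnitary (Subrepresentation.toRepresentation (ρ := ρ) ⟨W, fun k _ h => hW k h⟩) where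
  inner_map k v w := h.inner_map k v w
  locallyFinite v := by
    obtain ⟨U, hU, hv, hk⟩ := h.locallyFinite v
    refine ⟨U.comap W.subtype, ?_, hv, fun k x hx => hk k hx⟩
    have : FiniteDimensional ℂ U := .of_fg hU
    exact Submodule.fg_of_fg_map_injective _ W.injective_subtype
      (Submodule.FG.of_le hU (Submodule.map_comap_le _ _))
  weaklyContinuous v l := by
    obtain ⟨l', hl'⟩ := l.exists_extend
    rw [← hl']
    exact h.weaklyContinuous v l'
  finiteMultiplicities d τ hτ hc := by
    have := h.finiteMultiplicities d τ hτ hc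
    refine Submodule.fg_of_fg_map_injective (LinearMap.llcomp ℂ (Fin d → ℂ) W V W.subtype) ?_
      (Submodule.FG.of_le this ?_)
    · intro S S' hSS
      exact LinearMap.ext fun x => Subtype.ext (LinearMap.congr_fun hSS x)
    · rintro _ ⟨S, hS, rfl⟩ k w
      exact congrArg Subtype.val (hS k w)

/-- A stable subspace that separates points is the whole space. -/
theorem eq_top_of_orthogonal_eq_bot {W : Submodule ℂ V} (hW : ∀ k, W ≤ W.comap (ρ k))
    (hbot : Wᗮ = ⊥) : W = ⊤ := by
  refine (Submodule.eq_top_iff' ).2 fun w => ?_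
  obtain ⟨F₀, hF₀, hw, hk₀⟩ := h.locallyFinite w
  have : FiniteDimensional ℂ F₀ := .of_fg hF₀
  -- In an incomplete space a zero orthogonal complement alone does not give `W = ⊤`. Applying
  -- admissibility inside `W` to `N` yields a finite-dimensional `F ≤ W` whose complement in `W` is
  -- orthogonal to `w`. The part of `w` orthogonal to `F` is then orthogonal to all of `W`, hence
  -- zero.
  let N : Submodule ℂ W := F₀ᗮ.comap W.subtype
  have hN : N = LinearMap.ker ((F₀.orthogonalProjectionOnto : V →ₗ[ℂ] F₀) ∘ₗ W.subtype) := by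
    ext x
    simp [N]
  have hfin : FiniteDimensional ℂ (W ⧸ N) := by
    rw [hN]
    exact Module.Finite.equiv (LinearMap.quotKerEquivRange _).symm
  obtain ⟨F, hF, hFN⟩ := (h.restrict W hW).exists_orthogonal_le (N := N)
    (fun k x hx => h.orthogonal_le_comap hk₀ k hx)
  have : FiniteDimensional ℂ (F.map W.subtype) := .of_fg (hF.map _)
  obtain ⟨y, hy, z, hz, rfl⟩ := (F.map W.subtype).exists_add_mem_mem_orthogonal w
  have hyW : y ∈ W := (Submodule.map_subtype_le W F) hy
  suffices hz' : z ∈ Wᗮ by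
    rw [hbot] at hz'
    rw [(Submodule.mem_bot ℂ).1 hz', add_zero]
    exact hyW
  intro x hx
  have : FiniteDimensional ℂ F := .of_fg hF
  obtain ⟨x₁, hx₁, x₂, hx₂, hxx⟩ := F.exists_add_mem_mem_orthogonal (⟨x, hx⟩ : W)
  have hx' : x = x₁ + x₂ := congrArg Subtype.val hxx
  have h1 : inner ℂ (x₁ : V) z = 0 := hz _ ⟨x₁, hx₁, rfl⟩
  have h2 : inner ℂ (x₂ : V) (y + z) = 0 := inner_eq_zero_symm.1 (hFN hx₂ _ hw)
  have h3 : inner ℂ (x₂ : V) y = 0 := by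
    obtain ⟨y', hy', rfl⟩ := hy
    exact inner_eq_zero_symm.1 (hx₂ _ hy')
  rw [hx', inner_add_left, h1, zero_add]
  rwa [inner_add_right, h3, zero_add] at h2

end IsAdmissibleUnitary

end Unitary

/-! ### Matrix coefficients and vanishing by orthogonality to left finite functions. -/

section Coefficients

variable {K : Type*} [Group K] [TopologicalSpace K] [IsTopologicalGroup K] {V : Type*}
  [NormedAddCommGroup V] [InnerProductSpace ℂ V] {ρ : Representation ℂ K V}

/-- By unitarity, left translation by `k` replaces `w` by `ρ k⁻¹ w`, which stays in a
finite-dimensional stable subspace. -/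
theorem IsAdmissibleUnitary.exists_coefficient (h : IsAdmissibleUnitary ρ) (w v : V) :
    ∃ a ∈ leftFinite K, ∀ k, a k = inner ℂ w (ρ k v) := by
  let c : V →ₗ⋆[ℂ] C(K, ℂ) :=
    { toFun := fun w => ⟨fun k => inner ℂ w (ρ k v), h.weaklyContinuous v (innerₛₗ ℂ w)⟩
      map_add' := fun x y => by ext; exact inner_add_left _ _ _
      map_smul' := fun r x => by ext; exact inner_smul_left _ _ _ }
  obtain ⟨U, hU, hw, hk⟩ := h.locallyFinite w
  refine ⟨c w, ⟨U.map c, hU.map c, ⟨w, hw, rfl⟩, ?_⟩, fun _ => rfl⟩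
  rintro k _ ⟨u, hu, rfl⟩
  refine ⟨ρ k⁻¹ u, hk _ hu, ?_⟩
  ext x
  change inner ℂ (ρ k⁻¹ u) (ρ x v) = inner ℂ u (ρ (k * x) v)
  rw [h.inner_map_left, inv_inv, map_mul, Module.End.mul_apply]

theorem IsAdmissibleUnitary.eq_of_forall_leftFinite (h : IsAdmissibleUnitary ρ) {k k' : K}
    (hk : ∀ a ∈ leftFinite K, a k = a k') : ρ k = ρ k' := by
  ext v
  refine ext_inner_left ℂ fun w => ?_
  obtain ⟨a, ha, hav⟩ := h.exists_coefficient w v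
  rw [← hav, ← hav, hk a ha]

/-- A continuous function on `K` that is orthogonal to all left finite functions and factors through
the action of `K` on `V` vanishes. -/
theorem IsAdmissibleUnitary.eq_zero_of_forall_integral [CompactSpace K] [MeasurableSpace K]
    [BorelSpace K] (μ : Measure K) [IsFiniteMeasure μ] [μ.IsOpenPosMeasure]
    (h : IsAdmissibleUnitary ρ) (φ : K → ℂ) (hc : Continuous φ)
    (hφ : ∀ k k', ρ k = ρ k' → φ k = φ k') (h0 : ∀ a ∈ leftFinite K, ∫ k, a k * φ k ∂μ = 0)
    (k : K) : φ k = 0 :=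
  eq_zero_of_forall_integral_mul_eq_zero μ (leftFinite K) φ hc
    (fun _ _ hxy => hφ _ _ (h.eq_of_forall_leftFinite hxy)) h0 k

end Coefficients

/-! ### The conjugate dual of a Banach representation. -/

section ConjDual

/-- The space of continuous conjugate linear functionals. -/
abbrev ConjDual (E : Type*) [NormedAddCommGroup E] [NormedSpace ℂ E] := E →L⋆[ℂ] ℂ

variable {E : Type*} [NormedAddCommGroup E] [NormedSpace ℂ E]

theorem ConjDual.exists_apply_eq_norm (x : E) (hx : x ≠ 0) :
    ∃ η : ConjDual E, ‖η‖ ≤ 1 ∧ η x = ‖x‖ := by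
  obtain ⟨f, hf, hfx⟩ := exists_dual_vector ℂ x (norm_ne_zero_iff.2 hx)
  let η : E →ₗ⋆[ℂ] ℂ :=
    { toFun := fun y => star (f y)
      map_add' := by simp
      map_smul' := by simp }
  refine ⟨η.mkContinuous 1 fun y => ?_, LinearMap.mkContinuous_norm_le _ zero_le_one _, ?_⟩
  · have := f.le_opNorm y
    rw [hf] at this
    simpa [η] using this
  · simp [η, hfx]

/-- Evaluation of conjugate linear functionals. -/
def ConjDual.eval (x : E) : ConjDual E →L[ℂ] ℂ :=
  LinearMap.mkContinuous
    { toFun := fun η => η x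
      map_add' := fun _ _ => rfl
      map_smul' := fun _ _ => rfl } ‖x‖ fun η => by
    simpa [mul_comm] using η.le_opNorm x

@[simp] theorem ConjDual.eval_apply (x : E) (η : ConjDual E) : ConjDual.eval x η = η x := rfl

/-- The action of a group on the conjugate dual. -/
def dualAct {G : Type*} [Group G] (π : G →* (E →L[ℂ] E)) : G →* (ConjDual E →L[ℂ] ConjDual E) where
  toFun g := LinearMap.mkContinuous
    { toFun := fun η => η.comp (π g⁻¹)
      map_add' := fun _ _ => rfl
      map_smul' := fun _ _ => rfl } ‖π g⁻¹‖ fun η => by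
    rw [mul_comm]
    exact η.opNorm_comp_le (π g⁻¹)
  map_one' := by ext; simp
  map_mul' a b := by
    ext η x
    change η (π (a * b)⁻¹ x) = η (π b⁻¹ (π a⁻¹ x))
    rw [mul_inv_rev, map_mul]
    rfl

@[simp] theorem dualAct_apply {G : Type*} [Group G] (π : G →* (E →L[ℂ] E)) (g : G)
    (η : ConjDual E) (x : E) : dualAct π g η x = η (π g⁻¹ x) := rfl

end ConjDual

/-! ### Boundedness of the functionals given by vectors of `V`. -/

section Model

variable {G : Type*} [Group G] [TopologicalSpace G] {K : Subgroup G}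
  {V : Type*} [NormedAddCommGroup V] [InnerProductSpace ℂ V]
  {E : Type*} [NormedAddCommGroup E] [NormedSpace ℂ E]

/-- A uniformly bounded continuous representation `π` on a Banach space `E` that contains the
representation `ρ` of `K` densely. -/
structure IsBoundedModel (ρ : Representation ℂ K V) (π : G →* (E →L[ℂ] E)) (ι : V →ₗ[ℂ] E)
    (C : ℝ) : Prop where
  continuous_uncurry : Continuous fun x : G × E => π x.1 x.2
  injective : Function.Injective ι
  denseRange : DenseRange ι
  map_ι : ∀ (k : K) (v : V), π k (ι v) = ι (ρ k v)
  pos : 0 < C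
  norm_le : ∀ g x, ‖π g x‖ ≤ C * ‖x‖

namespace IsBoundedModel

variable {ρ : Representation ℂ K V} {π : G →* (E →L[ℂ] E)} {ι : V →ₗ[ℂ] E} {C : ℝ}
  (h : IsBoundedModel ρ π ι C)
include h

theorem continuous_apply {X : Type*} [TopologicalSpace X] {f : X → G} {e : X → E}
    (hf : Continuous f) (he : Continuous e) : Continuous fun x => π (f x) (e x) :=
  h.continuous_uncurry.comp (hf.prodMk he)

/-- Together with `π_inv_eq` this shows that functions on `K` built from `π` factor through `ρ`, as
`eq_zero_of_forall_integral` requires. -/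
theorem π_eq {k k' : K} (hk : ρ k = ρ k') : π k = π k' :=
  DFunLike.coe_injective (h.denseRange.equalizer (π k).continuous (π k').continuous
    (funext fun v => by simp [h.map_ι, hk]))

theorem π_inv_eq {k k' : K} (hk : ρ k = ρ k') : π (k : G)⁻¹ = π (k' : G)⁻¹ := by
  have : ρ k⁻¹ = ρ k'⁻¹ := by
    ext v
    have h1 : ρ k (ρ k⁻¹ v) = v := by simp
    have h2 : ρ k'⁻¹ (ρ k' (ρ k⁻¹ v)) = ρ k⁻¹ v := by simp
    rw [← h2, ← hk, h1]
  exact h.π_eq this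

theorem conjDual_ext {η η' : ConjDual E} (hη : ∀ v, η (ι v) = η' (ι v)) : η = η' :=
  DFunLike.coe_injective (h.denseRange.equalizer η.continuous η'.continuous (funext hη))

theorem opNorm_le_of_forall (η : ConjDual E) {M : ℝ} (hM : 0 ≤ M)
    (hη : ∀ v, ‖η (ι v)‖ ≤ M * ‖ι v‖) : ‖η‖ ≤ M :=
  η.opNorm_le_bound hM fun x => h.denseRange.induction_on x
    (isClosed_le (by fun_prop) (by fun_prop)) hη

theorem norm_dualAct_le (g : G) (η : ConjDual E) : ‖dualAct π g η‖ ≤ C * ‖η‖ :=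
  ContinuousLinearMap.opNorm_le_bound _ (mul_nonneg h.pos.le (norm_nonneg _)) fun x => by
    rw [dualAct_apply]
    calc ‖η (π g⁻¹ x)‖ ≤ ‖η‖ * ‖π g⁻¹ x‖ := η.le_opNorm _
      _ ≤ ‖η‖ * (C * ‖x‖) := by gcongr; exact h.norm_le _ _
      _ = C * ‖η‖ * ‖x‖ := by ring

theorem norm_apply_le (η : ConjDual E) (g : G) (x : E) : ‖η (π g x)‖ ≤ C * ‖η‖ * ‖x‖ := by
  have := (dualAct π g⁻¹ η).le_of_opNorm_le (h.norm_dualAct_le g⁻¹ η) x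
  simpa using this

variable [IsTopologicalGroup G]

/-- Averages of translates of functionals. -/
theorem exists_average {X : Type*} [TopologicalSpace X] [MeasurableSpace X] [BorelSpace X]
    (μ : Measure X) [IsFiniteMeasureOnCompacts μ] (f : X → ℂ) (hf : Continuous f)
    (hfs : HasCompactSupport f) (j : X → G) (hj : Continuous j) (η : ConjDual E) :
    ∃ η' : ConjDual E, (∀ x, η' x = ∫ k, f k * η (π (j k)⁻¹ x) ∂μ) ∧
      ‖η'‖ ≤ C * ‖η‖ * ∫ k, ‖f k‖ ∂μ := by
  have hint : ∀ x, Integrable (fun k => f k * η (π (j k)⁻¹ x)) μ := fun x => by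
    have h1 : Continuous fun k => π (j k)⁻¹ x := h.continuous_apply hj.inv continuous_const
    exact (hf.mul (η.continuous.comp h1)).integrable_of_hasCompactSupport hfs.mul_right
  -- The average is defined weakly, vector by vector, because the orbit of a general functional need
  -- not be norm-continuous.
  let L : E →ₗ⋆[ℂ] ℂ :=
    { toFun := fun x => ∫ k, f k * η (π (j k)⁻¹ x) ∂μ
      map_add' := fun x y => by
        rw [← integral_add (hint x) (hint y)]
        simp [mul_add]
      map_smul' := fun c x => by
        rw [smul_eq_mul, ← integral_const_mul]
        simp [mul_left_comm] }
  have hL : ∀ x, ‖L x‖ ≤ (C * ‖η‖ * ∫ k, ‖f k‖ ∂μ) * ‖x‖ := fun x => by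
    calc ‖L x‖ ≤ ∫ k, ‖f k‖ * (C * ‖η‖ * ‖x‖) ∂μ := by
          refine norm_integral_le_of_norm_le ?_ (.of_forall fun k => ?_)
          · exact (hf.integrable_of_hasCompactSupport hfs).norm.mul_const _
          · rw [norm_mul]
            gcongr
            exact h.norm_apply_le _ _ _
      _ = _ := by rw [integral_mul_const]; ring
  refine ⟨L.mkContinuous _ hL, fun x => rfl, LinearMap.mkContinuous_norm_le _ ?_ _⟩
  exact mul_nonneg (mul_nonneg h.pos.le (norm_nonneg _)) (integral_nonneg fun _ => norm_nonneg _)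

omit [IsTopologicalGroup G] in
/-- `K`-finite functionals are given by vectors of `V`. -/
theorem exists_eq_inner_of_fg (hρ : IsAdmissibleUnitary ρ) {W : Submodule ℂ (ConjDual E)}
    (hW : W.FG) (hWk : ∀ k : K, ∀ η ∈ W, dualAct π k η ∈ W) {η : ConjDual E} (hη : η ∈ W) :
    ∃ w, ∀ v, η (ι v) = inner ℂ v w := by
  obtain ⟨T, rfl⟩ := hW
  -- Its kernel, the set of common zeros of the functionals in `W`, is `K`-stable and of finite
  -- codimension. Conjugation makes the map linear.
  let f : V →ₗ[ℂ] (T → ℂ) :=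
    { toFun := fun v b => star ((b : ConjDual E) (ι v))
      map_add' := fun v w => by ext; simp
      map_smul' := fun c v => by ext; simp }
  have hker : ∀ v, v ∈ LinearMap.ker f ↔
      ∀ b ∈ Submodule.span ℂ (T : Set (ConjDual E)), b (ι v) = 0 := by
    intro v
    constructor
    · intro hv b hb
      induction hb using Submodule.span_induction with
      | mem b hb => simpa [f] using congrFun hv ⟨b, hb⟩
      | zero => simp
      | add b c _ _ hb hc => simp [hb, hc]
      | smul r b _ hb => simp [hb]
    · intro hv
      ext b
      simp [f, hv b (Submodule.subset_span b.2)]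
  have hstable : ∀ k, LinearMap.ker f ≤ (LinearMap.ker f).comap (ρ k) := by
    intro k v hv
    rw [Submodule.mem_comap]
    rw [hker] at hv ⊢
    intro b hb
    have := hv _ (hWk k⁻¹ b hb)
    rwa [dualAct_apply, ← Subgroup.coe_inv, inv_inv, h.map_ι] at this
  have hfd : FiniteDimensional ℂ (V ⧸ LinearMap.ker f) :=
    Module.Finite.equiv (LinearMap.quotKerEquivRange f).symm
  exact hρ.exists_eq_inner hstable ((η : E →ₗ⋆[ℂ] ℂ).comp ι) fun v hv => (hker v).1 hv η hη

variable [CompactSpace K] [MeasurableSpace K] [BorelSpace K] (μ : Measure K) [IsFiniteMeasure μ]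
  [μ.IsMulLeftInvariant] (hρ : IsAdmissibleUnitary ρ)
include hρ

/-- Averages against left finite functions are `K`-finite, hence given by vectors of `V`. -/
theorem exists_average_eq_inner (η : ConjDual E) {a : C(K, ℂ)} (ha : a ∈ leftFinite K) :
    ∃ w, ∀ v, ∫ k : K, a k * η (π (k : G)⁻¹ (ι v)) ∂μ = inner ℂ v w := by
  obtain ⟨W, hW, haW, hWk⟩ := ha
  have hex : ∀ b : C(K, ℂ), ∃ η' : ConjDual E,
      ∀ x, η' x = ∫ k : K, b k * η (π (k : G)⁻¹ x) ∂μ := fun b =>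
    (h.exists_average μ b b.continuous (HasCompactSupport.of_compactSpace _) (fun k : K => (k : G))
      continuous_subtype_val η).imp fun _ h => h.1
  choose A hA using hex
  have hi : ∀ (b : C(K, ℂ)) x, Integrable (fun k : K => b k * η (π (k : G)⁻¹ x)) μ := fun b x =>
    integrable_of_continuous μ (b.continuous.mul (η.continuous.comp
      (h.continuous_apply continuous_subtype_val.inv continuous_const)))
  let L : C(K, ℂ) →ₗ[ℂ] ConjDual E :=
    { toFun := A
      map_add' := fun b c => by
        ext x
        rw [add_apply, hA, hA, hA, ← integral_add (hi b x) (hi c x)]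
        simp [add_mul]
      map_smul' := fun r b => by
        ext x
        rw [RingHom.id_apply, smul_apply, hA, hA, smul_eq_mul, ← integral_const_mul]
        simp [mul_assoc] }
  -- By invariance of `μ`, translating an average of `η` amounts to translating its weight, so the
  -- image of `W` is a finite-dimensional `K`-stable space of functionals.
  have hL : ∀ k₀ : K, ∀ ζ ∈ W.map L, dualAct π (k₀ : G) ζ ∈ W.map L := by
    rintro k₀ _ ⟨b, hb, rfl⟩
    refine ⟨_, hWk k₀⁻¹ b hb, ?_⟩
    ext x
    change A _ x = A b _
    rw [hA, hA, ← integral_mul_left_eq_self _ k₀]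
    simp
  obtain ⟨w, hw⟩ := h.exists_eq_inner_of_fg hρ (hW.map L) hL ⟨a, haW, rfl⟩
  exact ⟨w, fun v => by rw [← hw v, ← hA]; rfl⟩

variable [μ.IsOpenPosMeasure]

omit [IsTopologicalGroup G] [CompactSpace K] [MeasurableSpace K] [BorelSpace K] [IsFiniteMeasure μ]
  [μ.IsMulLeftInvariant] [μ.IsOpenPosMeasure] in
theorem dualAct_eq {ξ : ConjDual E} {w : V} (hξ : ∀ v, ξ (ι v) = inner ℂ v w) (k : K) (v : V) :
    dualAct π (k : G) ξ (ι v) = inner ℂ v (ρ k w) := by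
  rw [dualAct_apply, ← Subgroup.coe_inv, h.map_ι, hξ, hρ.inner_map_left, inv_inv]

include μ in
/-- The functionals given by the vectors of `V` are continuous. -/
theorem exists_conjDual : ∃ ξ : V →ₗ[ℂ] ConjDual E, ∀ w v, ξ w (ι v) = inner ℂ v w := by
  suffices hall : ∀ w, ∃ ξ : ConjDual E, ∀ v, ξ (ι v) = inner ℂ v w by
    choose ξ hξ using hall
    exact ⟨{  toFun := ξ
              map_add' := fun w w' => h.conjDual_ext fun v => by simp [hξ]
              map_smul' := fun c w => h.conjDual_ext fun v => by simp [hξ] }, hξ⟩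
  let W : Submodule ℂ V :=
    { carrier := {w | ∃ ξ : ConjDual E, ∀ v, ξ (ι v) = inner ℂ v w}
      add_mem' := fun ⟨ξ, hξ⟩ ⟨ξ', hξ'⟩ => ⟨ξ + ξ', fun v => by simp [hξ, hξ']⟩
      zero_mem' := ⟨0, by simp⟩
      smul_mem' := fun c _ ⟨ξ, hξ⟩ => ⟨c • ξ, fun v => by simp [hξ]⟩ }
  have hW : W = ⊤ := by
    refine hρ.eq_top_of_orthogonal_eq_bot (fun k w ⟨ξ, hξ⟩ => ⟨_, h.dualAct_eq hρ hξ k⟩) ?_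
    -- Suppose `v ≠ 0` is orthogonal to every `w` with bounded functional, and take `η` with `η (ι
    -- v) ≠ 0`. All averages of `η` come from such `w` and kill `v`, so `k ↦ η (π k⁻¹ (ι v))` is
    -- orthogonal to the left finite functions and vanishes at `1`, a contradiction.
    refine (Submodule.eq_bot_iff _).2 fun v hv => ?_
    by_contra hv0
    have hv0' : ι v ≠ 0 := fun h0 => hv0 (h.injective (h0.trans (map_zero ι).symm))
    obtain ⟨η, -, hη⟩ := ConjDual.exists_apply_eq_norm _ hv0'
    have h1 : Continuous fun k : K => π (k : G)⁻¹ (ι v) :=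
      h.continuous_apply continuous_subtype_val.inv continuous_const
    have := hρ.eq_zero_of_forall_integral μ (fun k : K => η (π (k : G)⁻¹ (ι v)))
      (η.continuous.comp h1) (fun k k' hk => by rw [h.π_inv_eq hk]) (fun a ha => ?_) 1
    · simp [hη, hv0'] at this
    · obtain ⟨w, hw⟩ := h.exists_average_eq_inner μ hρ η ha
      obtain ⟨η', hη', -⟩ := h.exists_average μ a a.continuous
        (HasCompactSupport.of_compactSpace _) (fun k : K => (k : G)) continuous_subtype_val η
      rw [hw]
      exact inner_eq_zero_symm.1 (hv w ⟨η', fun v => by rw [hη', hw]⟩)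
  exact fun w => (hW ▸ trivial : w ∈ W)

end IsBoundedModel

end Model

/-- A point outside a closed subspace is separated from it by a continuous functional. -/
theorem Submodule.exists_continuousLinearMap_ne_zero {E : Type*} [NormedAddCommGroup E]
    [NormedSpace ℂ E] (P : Submodule ℂ E) (hP : IsClosed (P : Set E)) {x : E} (hx : x ∉ P) :
    ∃ f : E →L[ℂ] ℂ, f x ≠ 0 ∧ ∀ y ∈ P, f y = 0 := by
  have hne : ‖P.mkQL x‖ ≠ 0 := fun h0 => by
    have := (QuotientAddGroup.norm_mk_eq_zero_iff_mem_closure (S := P.toAddSubgroup)).1 h0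
    exact hx (hP.closure_subset this)
  obtain ⟨f, -, hf⟩ := exists_dual_vector ℂ (P.mkQL x) hne
  refine ⟨f ∘L P.mkQL, ?_, fun y hy => ?_⟩
  · rw [ContinuousLinearMap.comp_apply, hf]
    exact RCLike.ofReal_ne_zero.2 hne
  · have : P.mkQL y = 0 := (Submodule.Quotient.mk_eq_zero P).2 hy
    rw [ContinuousLinearMap.comp_apply, this, map_zero]

/-! ### Norm continuity of the action of `G` on the functionals given by `V`. -/

section Model

open scoped Pointwise

variable {G : Type*} [Group G] [TopologicalSpace G] {K : Subgroup G}
  {V : Type*} [NormedAddCommGroup V] [InnerProductSpace ℂ V]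
  {E : Type*} [NormedAddCommGroup E] [NormedSpace ℂ E]

namespace IsBoundedModel

variable {ρ : Representation ℂ K V} {π : G →* (E →L[ℂ] E)} {ι : V →ₗ[ℂ] E} {C : ℝ}
  (h : IsBoundedModel ρ π ι C) [IsTopologicalGroup G]
include h

/-- The Gårding functionals `∫ f(g) g·η dg` depend norm-continuously on translation. -/
theorem continuous_dualAct_average [LocallyCompactSpace G] [MeasurableSpace G] [BorelSpace G]
    (ν : Measure G) [ν.IsMulLeftInvariant] [IsFiniteMeasureOnCompacts ν] (f : G → ℂ)
    (hf : Continuous f) (hfs : HasCompactSupport f) (η η' : ConjDual E)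
    (hη' : ∀ x, η' x = ∫ k, f k * η (π k⁻¹ x) ∂ν) : Continuous fun g => dualAct π g η' := by
  refine continuous_iff_continuousAt.2 fun g₀ => ?_
  -- For `g` in a compact neighbourhood all translates of `f` are supported in one compact set, so
  -- their `L¹` distance is continuous in `g`.
  obtain ⟨S, hS, hg₀⟩ := exists_compact_mem_nhds g₀
  have hsupp : ∀ g ∈ S, ∀ x, x ∉ S * tsupport f → f (g⁻¹ * x) = 0 := fun g hg x hx => by
    by_contra hne
    exact hx ⟨g, hg, g⁻¹ * x, subset_tsupport f hne, by simp⟩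
  have hcpt : ∀ g : G, HasCompactSupport fun x => f (g⁻¹ * x) := fun g =>
    hfs.comp_homeomorph (Homeomorph.mulLeft g⁻¹)
  have hcont : ∀ g : G, Continuous fun x => f (g⁻¹ * x) := fun g => by fun_prop
  -- Invariance of `ν` turns translation of the functional into translation of `f`; the difference
  -- is again an average, bounded by an `L¹` norm.
  have hbound : ∀ g, ‖dualAct π g η' - dualAct π g₀ η'‖ ≤
      C * ‖η‖ * ∫ x, ‖f (g⁻¹ * x) - f (g₀⁻¹ * x)‖ ∂ν := fun g => by
    obtain ⟨η₁, h₁, hn⟩ := h.exists_average ν (fun x => f (g⁻¹ * x) - f (g₀⁻¹ * x))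
      (by fun_prop) ((hcpt g).sub (hcpt g₀)) id continuous_id η
    convert hn
    ext x
    have h2 : Continuous fun k : G => η (π k⁻¹ x) :=
      η.continuous.comp (h.continuous_apply continuous_inv continuous_const)
    have h3 : ∀ g : G, Integrable (fun k => f (g⁻¹ * k) * η (π k⁻¹ x)) ν := fun g =>
      ((hcont g).mul h2).integrable_of_hasCompactSupport (hcpt g).mul_right
    have h4 : ∀ g : G, dualAct π g η' x = ∫ k, f (g⁻¹ * k) * η (π k⁻¹ x) ∂ν := fun g => by
      rw [dualAct_apply, hη', ← integral_mul_left_eq_self _ g⁻¹]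
      simp [← mul_apply_eq_comp, ← map_mul]
    rw [h₁, sub_apply, h4, h4, ← integral_sub (h3 g) (h3 g₀)]
    simp [sub_mul]
  have hlim : ContinuousAt (fun g => C * ‖η‖ * ∫ x, ‖f (g⁻¹ * x) - f (g₀⁻¹ * x)‖ ∂ν) g₀ := by
    refine continuousAt_const.mul (ContinuousOn.continuousAt (s := S) ?_ hg₀)
    refine continuousOn_integral_of_compact_support (hS.mul hfs) ?_ fun g x hg hx => ?_
    · exact Continuous.continuousOn (by fun_prop)
    · rw [hsupp g hg x hx, hsupp g₀ (mem_of_mem_nhds hg₀) x hx, sub_zero, norm_zero]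
  refine tendsto_iff_norm_sub_tendsto_zero.2 ?_
  refine squeeze_zero (fun _ => norm_nonneg _) hbound ?_
  have := hlim.tendsto
  simpa using this

variable [CompactSpace K] [MeasurableSpace K] [BorelSpace K] (μ : Measure K) [IsFiniteMeasure μ]
  [μ.IsMulLeftInvariant] [μ.IsOpenPosMeasure] (hρ : IsAdmissibleUnitary ρ)
include hρ μ

/-- `G` acts norm-continuously on the functionals given by the vectors of `V`. -/
theorem continuous_dualAct [LocallyCompactSpace G] {ξ : ConjDual E} {w : V}
    (hξ : ∀ v, ξ (ι v) = inner ℂ v w) : Continuous fun g => dualAct π g ξ := by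
  let W : Submodule ℂ V :=
    { carrier := {w | ∃ ξ : ConjDual E, (∀ v, ξ (ι v) = inner ℂ v w) ∧
        Continuous fun g => dualAct π g ξ}
      add_mem' := fun ⟨ξ, hξ, hc⟩ ⟨ξ', hξ', hc'⟩ => ⟨ξ + ξ', fun v => by simp [hξ, hξ'],
        by simpa using! hc.add hc'⟩
      zero_mem' := ⟨0, by simp, by simpa using continuous_const⟩
      smul_mem' := fun c _ ⟨ξ, hξ, hc⟩ => ⟨c • ξ, fun v => by simp [hξ],
        by simpa using! hc.const_smul c⟩ }
  suffices hW : W = ⊤ by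
    obtain ⟨ξ', hξ', hc⟩ := (hW ▸ trivial : w ∈ W)
    rwa [h.conjDual_ext (η := ξ) (η' := ξ') fun v => by rw [hξ, hξ']]
  refine hρ.eq_top_of_orthogonal_eq_bot (fun k w ⟨ξ, hξ, hc⟩ =>
    ⟨_, h.dualAct_eq hρ hξ k, ?_⟩) ?_
  · have : Continuous fun g : G => dualAct π (g * k) ξ := hc.comp (continuous_mul_const (k : G))
    simpa using this
  refine (Submodule.eq_bot_iff _).2 fun v hv => ?_
  by_contra hv0
  have hv0' : ι v ≠ 0 := fun h0 => hv0 (h.injective (h0.trans (map_zero ι).symm))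
  obtain ⟨η, -, hη⟩ := ConjDual.exists_apply_eq_norm _ hv0'
  borelize G
  let ν : Measure G := Measure.haar
  -- a Gårding functional that does not vanish on `v`
  obtain ⟨χ, hχ, hχ0, hχ1⟩ := exists_continuous_nonneg_pos (1 : G)
  let φ : G → ℂ := fun g => η (π g⁻¹ (ι v))
  have hφ : Continuous φ := η.continuous.comp (h.continuous_apply continuous_inv continuous_const)
  -- The conjugate factor makes `η' (ι v)` the integral of `χ |φ|²`, which is positive.
  let f : G → ℂ := fun g => χ g * star (φ g)
  have hf : Continuous f := by fun_prop
  have hfs : HasCompactSupport f :=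
    HasCompactSupport.mul_right (hχ.comp_left (g := fun r : ℝ => (r : ℂ)) Complex.ofReal_zero)
  obtain ⟨η', hη', -⟩ := h.exists_average ν f hf hfs id continuous_id η
  have hη'v : η' (ι v) ≠ 0 := by
    have h1 : η' (ι v) = ((∫ g, χ g * ‖φ g‖ ^ 2 ∂ν : ℝ) : ℂ) := by
      rw [hη', ← integral_complex_ofReal]
      refine integral_congr_ae (.of_forall fun g => ?_)
      have := RCLike.conj_mul (φ g)
      simp only [f, id, Complex.ofReal_mul, mul_assoc]
      congr 1
      simpa using this
    rw [h1]
    have hc : Continuous fun g => χ g * ‖φ g‖ ^ 2 := by fun_prop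
    exact_mod_cast (hc.integral_pos_of_hasCompactSupport_nonneg_nonzero (μ := ν) (x := 1)
      hχ.mul_right (fun g => mul_nonneg (hχ0 g) (by positivity))
      (mul_ne_zero hχ1 (by simp [φ, hη, hv0']))).ne'
  have hη'c := h.continuous_dualAct_average ν f hf hfs η η' hη'
  have h1 : Continuous fun k : K => π (k : G)⁻¹ (ι v) :=
    h.continuous_apply continuous_subtype_val.inv continuous_const
  refine hη'v ?_
  have := hρ.eq_zero_of_forall_integral μ (fun k : K => η' (π (k : G)⁻¹ (ι v)))
    (η'.continuous.comp h1) (fun k k' hk => by rw [h.π_inv_eq hk]) (fun a ha => ?_) 1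
  · simpa using this
  obtain ⟨w, hw⟩ := h.exists_average_eq_inner μ hρ η' ha
  obtain ⟨ζ, hζ, -⟩ := h.exists_average μ a a.continuous
    (HasCompactSupport.of_compactSpace _) (fun k : K => (k : G)) continuous_subtype_val η'
  rw [hw]
  refine inner_eq_zero_symm.1 (hv w ⟨ζ, fun v => by rw [hζ, hw], ?_⟩)
  -- Averaging over `K` preserves norm continuity: the translate by `g` is the Bochner integral of
  -- `a k • dualAct π (g * k) η'`, whose integrand is jointly continuous.
  have hcont : Continuous fun p : G × K => a p.2 • dualAct π (p.1 * p.2) η' :=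
    (a.continuous.comp continuous_snd).smul
      (hη'c.comp (continuous_fst.mul (continuous_subtype_val.comp continuous_snd)))
  have hint : Continuous fun g : G => ∫ k : K, a k • dualAct π (g * k) η' ∂μ :=
    continuousOn_univ.1 (continuousOn_integral_of_compact_support (k := Set.univ) isCompact_univ
      hcont.continuousOn (by simp))
  convert hint using 2 with g
  ext x
  have hi : Integrable (fun k : K => a k • dualAct π (g * k) η') μ :=
    integrable_of_continuous μ (hcont.comp (Continuous.prodMk_right g))
  rw [← ConjDual.eval_apply x (∫ k : K, _ ∂μ), ← ContinuousLinearMap.integral_comp_comm _ hi,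
    dualAct_apply, hζ]
  refine integral_congr_ae (.of_forall fun k => ?_)
  simp

/-- The closure of the space of functionals given by the vectors of `V` is stable under `G`. -/
theorem dualAct_mem_closure [LocallyCompactSpace G] {ξ : V →ₗ[ℂ] ConjDual E}
    (hξ : ∀ w v, ξ w (ι v) = inner ℂ v w) (g : G) (w : V) :
    dualAct π g (ξ w) ∈ (LinearMap.range ξ).topologicalClosure := by
  by_contra hmem
  set P := (LinearMap.range ξ).topologicalClosure
  -- Hahn-Banach: `Λ` kills the closure but not the translate. The `K`-averages of the translate are
  -- of the form `ξ w'`, so `Λ` kills them, and by orthogonality it kills the translate too.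
  obtain ⟨Λ, hΛ, hΛP⟩ : ∃ Λ : ConjDual E →L[ℂ] ℂ, Λ (dualAct π g (ξ w)) ≠ 0 ∧ ∀ x ∈ P, Λ x = 0 := by
    exact P.exists_continuousLinearMap_ne_zero (Submodule.isClosed_topologicalClosure _) hmem
  have hc := h.continuous_dualAct μ hρ (hξ w)
  have hcK : Continuous fun k : K => dualAct π (k : G) (dualAct π g (ξ w)) := by
    have : Continuous fun k : K => dualAct π ((k : G) * g) (ξ w) :=
      hc.comp (continuous_subtype_val.mul continuous_const)
    simpa using this
  refine hΛ ?_
  have := hρ.eq_zero_of_forall_integral μ (fun k : K => Λ (dualAct π (k : G) (dualAct π g (ξ w))))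
    (Λ.continuous.comp hcK) (fun k k' hk => ?_) (fun a ha => ?_) 1
  · simpa using this
  · congr 1
    ext x
    simp only [dualAct_apply, h.π_inv_eq hk]
  · obtain ⟨w', hw'⟩ := h.exists_average_eq_inner μ hρ (dualAct π g (ξ w)) ha
    have hi : Integrable (fun k : K => a k • dualAct π (k : G) (dualAct π g (ξ w))) μ :=
      integrable_of_continuous μ (a.continuous.smul hcK)
    have h1 : ∫ k : K, a k • dualAct π (k : G) (dualAct π g (ξ w)) ∂μ = ξ w' := by
      refine h.conjDual_ext fun v => ?_
      rw [hξ, ← hw', ← ConjDual.eval_apply (ι v) (∫ k : K, _ ∂μ),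
        ← ContinuousLinearMap.integral_comp_comm _ hi]
      rfl
    have h2 := ContinuousLinearMap.integral_comp_comm Λ hi
    simp only [map_smul, smul_eq_mul] at h2
    rw [h2, h1]
    exact hΛP _ (Submodule.le_topologicalClosure _ ⟨w', rfl⟩)

end IsBoundedModel

end Model

/-! ### One-parameter subgroups and the derivative of the dual action. -/

namespace RealReductiveGroup

variable {G : Type*} [Group G] [TopologicalSpace G] {R : RealReductiveGroup G}

theorem IsExpCurve.map_zero {X : R.lieAlgebra} {c : ℝ → G} (hc : R.IsExpCurve X c) : c 0 = 1 := by
  have := hc.map_add 0 0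
  rw [add_zero] at this
  exact (left_eq_mul.1 this)

theorem IsExpCurve.map_neg {X : R.lieAlgebra} {c : ℝ → G} (hc : R.IsExpCurve X c) (t : ℝ) :
    c (-t) = (c t)⁻¹ := by
  rw [eq_inv_iff_mul_eq_one, ← hc.map_add, neg_add_cancel, hc.map_zero]

theorem IsExpCurve.conj [IsTopologicalGroup G] {X : R.lieAlgebra} {c : ℝ → G}
    (hc : R.IsExpCurve X c) (g : G) : R.IsExpCurve (R.Ad g X) fun t => g * c t * g⁻¹ where
  continuous := (continuous_const.mul hc.continuous).mul continuous_const
  map_add s t := by rw [hc.map_add]; group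
  toGL_eq t := by
    have h1 : (R.Ad g X : Matrix (Fin R.n) (Fin R.n) ℝ) =
      (R.toGL g : Matrix (Fin R.n) (Fin R.n) ℝ) * X *
      (((R.toGL g)⁻¹ : GL (Fin R.n) ℝ) : Matrix (Fin R.n) (Fin R.n) ℝ) := rfl
    rw [h1, ← Matrix.smul_mul, ← Matrix.mul_smul, Matrix.exp_units_conj, ← hc.toGL_eq, map_mul,
      map_mul, map_inv]
    rfl

theorem continuous_toGL (R : RealReductiveGroup G) : Continuous R.toGL :=
  continuous_subtype_val.comp R.continuous_proj

end RealReductiveGroup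

section Derivative

variable {G : Type*} [Group G] [TopologicalSpace G] {R : RealReductiveGroup G} {K : Subgroup G}
  {V : Type*} [NormedAddCommGroup V] [InnerProductSpace ℂ V]
  {E : Type*} [NormedAddCommGroup E] [NormedSpace ℂ E] {M : GKModule R K V}

theorem GKModule.continuous_gAct_Ad [IsTopologicalGroup G] (M : GKModule R K V) (X : R.lieAlgebra)
    (l : V →ₗ[ℂ] E) (v : V) : Continuous fun g => l (M.gAct (R.Ad g X) v) := by
  let f : R.lieAlgebra.toSubmodule →ₗ[ℝ] E :=
    { toFun := fun X => l (M.gAct X v)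
      map_add' := fun X Y => by
        have : M.gAct (X + Y) = M.gAct X + M.gAct Y := map_add M.gAct X Y
        rw [this]; simp
      map_smul' := fun r X => by
        have : M.gAct (r • X) = r • M.gAct X := map_smul M.gAct r X
        rw [this]
        exact (l.restrictScalars ℝ).map_smul r _ }
  obtain ⟨F, hF⟩ := f.exists_extend
  have hFc : Continuous F := F.continuous_of_finiteDimensional
  have h1 : ∀ g, l (M.gAct (R.Ad g X) v) = F ((R.toGL g : Matrix (Fin R.n) (Fin R.n) ℝ) * X *
      (((R.toGL g)⁻¹ : GL (Fin R.n) ℝ) : Matrix (Fin R.n) (Fin R.n) ℝ)) := fun g =>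
    (LinearMap.congr_fun hF (R.Ad g X)).symm
  simp only [h1]
  have h2 := R.continuous_toGL
  exact hFc.comp (((Units.continuous_val.comp h2).mul continuous_const).mul
    (Units.continuous_val.comp h2.inv))

/-- `π` differentiates to the action of `𝔤` on `V`, and has no further `K`-finite vectors. -/
structure IsGlobalModel (M : GKModule R K V) (π : G →* (E →L[ℂ] E)) (ι : V →ₗ[ℂ] E) (C : ℝ) : Prop
    extends IsBoundedModel M.kAct π ι C where
  kFinite : ∀ x : E, FiniteDimensional ℂ (Submodule.span ℂ (Set.range fun k : K => π k x)) →
    x ∈ Set.range ι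
  hasDerivAt : ∀ (X : R.lieAlgebra) (c : ℝ → G), R.IsExpCurve X c → ∀ v : V,
    HasDerivAt (fun t => π (c t) (ι v)) (ι (M.gAct X v)) 0

namespace IsGlobalModel

variable {π : G →* (E →L[ℂ] E)} {ι : V →ₗ[ℂ] E} {C : ℝ}
  (h : IsGlobalModel M π ι C)
include h

/-- The vector `π g (ι v)` need not lie in `V`, but `c t * g = c t₀ * g * (g⁻¹ * c (t - t₀) * g)`
moves the differentiation onto `v`, in the direction `Ad g⁻¹ X`. -/
theorem hasDerivAt_translate [IsTopologicalGroup G] {X : R.lieAlgebra} {c : ℝ → G}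
    (hc : R.IsExpCurve X c) (g : G) (v : V) (t₀ : ℝ) :
    HasDerivAt (fun t => π (c t) (π g (ι v))) (π (c t₀) (π g (ι (M.gAct (R.Ad g⁻¹ X) v)))) t₀ := by
  have h1 := h.hasDerivAt _ _ (hc.conj g⁻¹) v
  have h2 : HasDerivAt (fun t => π (g⁻¹ * c (t - t₀) * g⁻¹⁻¹) (ι v))
      (ι (M.gAct (R.Ad g⁻¹ X) v)) t₀ :=
    HasDerivAt.comp_sub_const (f := fun t => π (g⁻¹ * c t * g⁻¹⁻¹) (ι v)) t₀ t₀ (by simpa using h1)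
  have h3 := (((π (c t₀)).comp (π g)).restrictScalars ℝ).hasFDerivAt.comp_hasDerivAt t₀ h2
  refine h3.congr_of_eventuallyEq (.of_forall fun t => ?_)
  have : c t * g = c t₀ * g * (g⁻¹ * c (t - t₀) * g⁻¹⁻¹) := by
    rw [← add_sub_cancel t₀ t, hc.map_add]
    simp only [add_sub_cancel_left]
    group
  simp only [Function.comp_apply, ContinuousLinearMap.coe_restrictScalars',
    ContinuousLinearMap.comp_apply]
  rw [← mul_apply_eq_comp, ← map_mul, this]
  simp

theorem hasDerivAt_curve [IsTopologicalGroup G] {X : R.lieAlgebra} {c : ℝ → G}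
    (hc : R.IsExpCurve X c) (v : V) (t₀ : ℝ) :
    HasDerivAt (fun t => π (c t) (ι v)) (π (c t₀) (ι (M.gAct X v))) t₀ := by
  have h2 : HasDerivAt (fun t => π (c (t - t₀)) (ι v)) (ι (M.gAct X v)) t₀ :=
    HasDerivAt.comp_sub_const (f := fun t => π (c t) (ι v)) t₀ t₀
      (by simpa using h.hasDerivAt _ _ hc v)
  have h3 := ((π (c t₀)).restrictScalars ℝ).hasFDerivAt.comp_hasDerivAt t₀ h2
  refine h3.congr_of_eventuallyEq (.of_forall fun t => ?_)
  simp only [Function.comp_apply, ContinuousLinearMap.coe_restrictScalars']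
  rw [← mul_apply_eq_comp, ← map_mul, ← hc.map_add, add_sub_cancel]

variable [CompactSpace K] [MeasurableSpace K] [BorelSpace K] (μ : Measure K) [IsFiniteMeasure μ]
  [μ.IsMulLeftInvariant] [CompleteSpace E]

/-- `K`-averages of vectors against left finite functions belong to `V`. -/
theorem exists_ι_eq_integral [IsTopologicalGroup G] (x : E) {a : C(K, ℂ)} (ha : a ∈ leftFinite K) :
    ∃ v, ι v = ∫ k : K, a k • π k x ∂μ := by
  obtain ⟨W, hW, haW, hWk⟩ := ha
  have hc : Continuous fun k : K => π k x :=
    h.continuous_apply continuous_subtype_val continuous_const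
  have hi : ∀ b : C(K, ℂ), Integrable (fun k : K => b k • π k x) μ := fun b =>
    integrable_of_continuous μ (b.continuous.smul hc)
  let Ψ : C(K, ℂ) →ₗ[ℂ] E :=
    { toFun := fun b => ∫ k : K, b k • π k x ∂μ
      map_add' := fun b b' => by
        rw [← integral_add (hi b) (hi b')]
        simp [add_smul]
      map_smul' := fun c b => by
        rw [RingHom.id_apply, ← integral_smul]
        simp [mul_smul] }
  refine h.kFinite (Ψ a) ?_
  have hfd : FiniteDimensional ℂ (W.map Ψ) := .of_fg (hW.map Ψ)
  refine Submodule.finiteDimensional_of_le (S₂ := W.map Ψ) (Submodule.span_le.2 ?_)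
  rintro _ ⟨k₀, rfl⟩
  refine ⟨_, hWk k₀⁻¹ a haW, ?_⟩
  change ∫ k : K, leftTranslate k₀⁻¹ a k • π k x ∂μ = π k₀ (∫ k : K, a k • π k x ∂μ)
  rw [← ContinuousLinearMap.integral_comp_comm _ (hi a), ← integral_mul_left_eq_self _ k₀]
  simp

variable [μ.IsOpenPosMeasure] (hρ : IsAdmissibleUnitary M.kAct)
include hρ μ

/-- The action of an element of `𝔤` on translates of `V` is skew for the pairing with `V`. -/
theorem apply_skew [IsTopologicalGroup G] {X : R.lieAlgebra} {c : ℝ → G} (hc : R.IsExpCurve X c)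
    (hskew : ∀ v w, inner ℂ (M.gAct X v) w = - inner ℂ v (M.gAct X w)) {ξ ξ' : ConjDual E} {w : V}
    (hξ : ∀ v, ξ (ι v) = inner ℂ v w) (hξ' : ∀ v, ξ' (ι v) = inner ℂ v (M.gAct X w))
    {g : G} {v : V} {z : E} (hz : HasDerivAt (fun t => π (c t) (π g (ι v))) z 0) :
    ξ z = - ξ' (π g (ι v)) := by
  let D : K → E := fun k => π (k * g) (ι (M.gAct (R.Ad (k * g)⁻¹ X) v))
  have hD : ∀ (k : K) (t : ℝ), HasDerivAt (fun t => π (c t) (π (k * g) (ι v))) (π (c t) (D k)) t :=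
    fun k t => h.hasDerivAt_translate hc (k * g) v t
  have hD0 : ∀ k : K, HasDerivAt (fun t => π (c t) (π (k * g) (ι v))) (D k) 0 := fun k => by
    simpa [hc.map_zero] using hD k 0
  have hkg : Continuous fun k : K => (k : G) * g := continuous_subtype_val.mul continuous_const
  have hDc : Continuous D :=
    h.continuous_apply hkg ((M.continuous_gAct_Ad X ι v).comp hkg.inv)
  have hvc : Continuous fun k : K => π (k * g) (ι v) := h.continuous_apply hkg continuous_const
  have hzD : z = D 1 := hz.unique (by simpa using hD0 1)
  -- Skewness is known on `V` only, and `π g (ι v)` may lie outside it. The defect of skewness at `π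
  -- (k * g) (ι v)` is treated as a function of `k`; its averages vanish, and the value at `k = 1`
  -- is the claim.
  have key := hρ.eq_zero_of_forall_integral μ (fun k : K => ξ (D k) + ξ' (π (k * g) (ι v)))
    ((ξ.continuous.comp hDc).add (ξ'.continuous.comp hvc)) (fun k k' hk => ?_) (fun a ha => ?_) 1
  · rw [← hzD] at key
    simpa using eq_neg_of_add_eq_zero_left key
  · have h1 : π ((k : G) * g) = π ((k' : G) * g) := by rw [map_mul, map_mul, h.π_eq hk]
    have h2 : D k = D k' := (hD0 k).unique (by rw [h1]; exact hD0 k')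
    rw [h1, h2]
  -- The weight is conjugated because `ξ` and `ξ'` are conjugate linear. The averaged vector is some
  -- `v'` in `V`; differentiating under the integral identifies the average of `D` with `X v'`,
  -- where skewness applies.
  · have hb : star a ∈ leftFinite K := star_mem ha
    obtain ⟨v', hv'⟩ := h.exists_ι_eq_integral μ (π g (ι v)) hb
    have hDi : Integrable (fun k => (star a) k • D k) μ :=
      integrable_of_continuous μ ((star a).continuous.smul hDc)
    have hvi : Integrable (fun k => (star a) k • π (k * g) (ι v)) μ :=
      integrable_of_continuous μ ((star a).continuous.smul hvc)
    have hv'' : ι v' = ∫ k : K, (star a) k • π (k * g) (ι v) ∂μ := by simpa using hv'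
    have hder : HasDerivAt (fun t => ∫ k : K, (star a) k • π (c t) (π (k * g) (ι v)) ∂μ)
        (∫ k : K, (star a) k • D k ∂μ) 0 := by
      have := (hasDerivAt_integral_of_dominated_loc_of_deriv_le (μ := μ) (x₀ := (0 : ℝ))
        (F := fun t (k : K) => (star a) k • π (c t) (π (k * g) (ι v)))
        (F' := fun t k => (star a) k • π (c t) (D k))
        (bound := fun k => ‖(star a) k‖ * (C * ‖D k‖)) (s := Set.univ) Filter.univ_mem
        (.of_forall fun t => (integrable_of_continuous μ ((star a).continuous.smul
          ((π (c t)).continuous.comp hvc))).aestronglyMeasurable)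
        (integrable_of_continuous μ ((star a).continuous.smul ((π (c 0)).continuous.comp hvc)))
        (integrable_of_continuous μ
          ((star a).continuous.smul ((π (c 0)).continuous.comp hDc))).aestronglyMeasurable
        (.of_forall fun k t _ => by
          rw [norm_smul]
          gcongr
          exact h.norm_le _ _)
        (integrable_of_continuous μ ((star a).continuous.norm.mul (continuous_const.mul hDc.norm)))
        (.of_forall fun k t _ => (hD k t).const_smul _)).2
      simpa [hc.map_zero] using this
    have hder' : HasDerivAt (fun t => ∫ k : K, (star a) k • π (c t) (π (k * g) (ι v)) ∂μ)
        (ι (M.gAct X v')) 0 := by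
      refine (h.hasDerivAt X c hc v').congr_of_eventuallyEq (.of_forall fun t => ?_)
      dsimp only
      rw [hv'', ← ContinuousLinearMap.integral_comp_comm _ hvi]
      simp
    have h1 : ξ (∫ k : K, (star a) k • D k ∂μ) = ∫ k : K, a k * ξ (D k) ∂μ := by
      rw [← ContinuousLinearMap.integral_comp_commSL RCLike.conj_smul ξ hDi]
      simp
    have h2 : ξ' (∫ k : K, (star a) k • π (k * g) (ι v) ∂μ) =
        ∫ k : K, a k * ξ' (π (k * g) (ι v)) ∂μ := by
      rw [← ContinuousLinearMap.integral_comp_commSL RCLike.conj_smul ξ' hvi]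
      simp
    have h3 : Integrable (fun k => a k * ξ (D k)) μ :=
      integrable_of_continuous μ (a.continuous.mul (ξ.continuous.comp hDc))
    have h4 : Integrable (fun k => a k * ξ' (π (k * g) (ι v))) μ :=
      integrable_of_continuous μ (a.continuous.mul (ξ'.continuous.comp hvc))
    simp only [mul_add]
    rw [integral_add h3 h4, ← h1, ← h2,
      hder.unique hder', ← hv'', hξ, hξ', hskew, neg_add_cancel]

/-- The action of `G` on the functionals given by the vectors of `V` differentiates to the action
of `𝔤` on `V`. -/
theorem hasDerivAt_dualAct [IsTopologicalGroup G] [LocallyCompactSpace G] {X : R.lieAlgebra}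
    {c : ℝ → G} (hc : R.IsExpCurve X c)
    (hskew : ∀ v w, inner ℂ (M.gAct X v) w = - inner ℂ v (M.gAct X w)) {ξ ξ' : ConjDual E} {w : V}
    (hξ : ∀ v, ξ (ι v) = inner ℂ v w) (hξ' : ∀ v, ξ' (ι v) = inner ℂ v (M.gAct X w)) :
    HasDerivAt (fun t => dualAct π (c t) ξ) ξ' 0 := by
  -- A conjugate linear map is real linear, which is all the chain rule along a real curve needs.
  let ξr : E →L[ℝ] ℂ :=
    { toFun := ξ
      map_add' := map_add ξ
      map_smul' := fun r x => by
        have := ξ.map_smulₛₗ (r : ℂ) x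
        simpa using this
      cont := ξ.continuous }
  have hder : ∀ v t, HasDerivAt (fun t => dualAct π (c t) ξ (ι v))
      (dualAct π (c t) ξ' (ι v)) t := by
    intro v t
    have h1 := (h.hasDerivAt_curve hc v (-t)).scomp t (hasDerivAt_neg t)
    have h2 := ξr.hasFDerivAt.comp_hasDerivAt t h1
    have h3 : HasDerivAt (fun s => π (c s) (π (c (-t)) (ι v))) (π (c (-t)) (ι (M.gAct X v))) 0 := by
      have h4 := h.hasDerivAt X c hc v
      have h5 := ((π (c (-t))).restrictScalars ℝ).hasFDerivAt.comp_hasDerivAt 0 h4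
      refine h5.congr_of_eventuallyEq (.of_forall fun s => ?_)
      simp only [Function.comp_apply, ContinuousLinearMap.coe_restrictScalars']
      rw [← mul_apply_eq_comp, ← mul_apply_eq_comp, ← map_mul, ← map_mul, ← hc.map_add,
        ← hc.map_add, add_comm]
    have h6 : ξr ((-1 : ℝ) • π (c (-t)) (ι (M.gAct X v))) = dualAct π (c t) ξ' (ι v) := by
      rw [map_smul]
      change (-1 : ℝ) • ξ _ = _
      rw [h.apply_skew μ hρ hc hskew hξ hξ' h3, dualAct_apply, hc.map_neg]
      simp
    rw [← h6]
    refine h2.congr_of_eventuallyEq (.of_forall fun s => ?_)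
    simp only [Function.comp_apply, dualAct_apply, ← hc.map_neg]
    rfl
  have hcont := (h.continuous_dualAct μ hρ hξ').comp hc.continuous
  rw [hasDerivAt_iff_isLittleO_nhds_zero, Asymptotics.isLittleO_iff]
  intro ε hε
  have h0 : dualAct π (c 0) ξ' = ξ' := by simp [hc.map_zero]
  have hev : ∀ᶠ s in 𝓝 (0 : ℝ), ‖dualAct π (c s) ξ' - ξ'‖ < ε := by
    have := hcont.continuousAt (x := 0)
    have := (Metric.tendsto_nhds.1 this) ε hε
    simpa [dist_eq_norm, hc.map_zero] using this
  obtain ⟨δ, hδ, hball⟩ := Metric.eventually_nhds_iff_ball.1 hev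
  filter_upwards [Metric.ball_mem_nhds 0 hδ] with t ht
  refine h.opNorm_le_of_forall _ (by positivity) fun v => ?_
  -- The mean value inequality turns the derivatives at each `ι v` into a norm derivative: norm
  -- continuity of the orbit of `ξ'` gives the bound `ε ‖ι v‖` on one interval for all `v`.
  have := (convex_ball (0 : ℝ) δ).norm_image_sub_le_of_norm_hasDerivWithin_le
    (f := fun t => dualAct π (c t) ξ (ι v) - t • ξ' (ι v)) (C := ε * ‖ι v‖)
    (fun s hs => ((hder v s).sub ((hasDerivAt_id s).smul_const (ξ' (ι v)))).hasDerivWithinAt)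
    (fun s hs => ?_) (Metric.mem_ball_self hδ) ht
  · simp only [zero_add, zero_smul, sub_zero] at this ⊢
    simp only [sub_apply, smul_apply]
    calc _ = ‖dualAct π (c t) ξ (ι v) - t • ξ' (ι v) - dualAct π (c 0) ξ (ι v)‖ := by
          congr 1; ring
      _ ≤ _ := this
      _ = _ := by ring
  · have h1 := (dualAct π (c s) ξ' - ξ').le_of_opNorm_le (hball s hs).le (ι v)
    simpa using h1

end IsGlobalModel

end Derivative

/-! ### Biduality, and density arguments for uniformly bounded families. -/

/-- The functionals given by the vectors of `V` determine the norm of `E` on `V` up to a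
constant. -/
theorem IsBoundedModel.norm_le_of_forall_inner {G : Type*} [Group G] [TopologicalSpace G]
    {K : Subgroup G} {V : Type*} [NormedAddCommGroup V] [InnerProductSpace ℂ V] {E : Type*}
    [NormedAddCommGroup E] [NormedSpace ℂ E] {ρ : Representation ℂ K V} {π : G →* (E →L[ℂ] E)}
    {ι : V →ₗ[ℂ] E} {C : ℝ} (h : IsBoundedModel ρ π ι C) [IsTopologicalGroup G] [CompactSpace K]
    [MeasurableSpace K] [BorelSpace K] (μ : Measure K) [IsFiniteMeasure μ] [μ.IsMulLeftInvariant]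
    [μ.IsOpenPosMeasure] (hρ : IsAdmissibleUnitary ρ) {ξ : V →ₗ[ℂ] ConjDual E}
    (hξ : ∀ w v, ξ w (ι v) = inner ℂ v w) {v : V} {m : ℝ} (hm : 0 ≤ m)
    (hv : ∀ w, ‖inner ℂ v w‖ ≤ m * ‖ξ w‖) : ‖ι v‖ ≤ 4 * C * m := by
  by_cases hv0 : ι v = 0
  · rw [hv0, norm_zero]
    have := h.pos
    positivity
  have hpos : 0 < ‖ι v‖ := norm_pos_iff.2 hv0
  have hCpos := h.pos
  obtain ⟨η, hη1, hη⟩ := ConjDual.exists_apply_eq_norm _ hv0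
  have hvc : Continuous fun k : K => π (k : G)⁻¹ (ι v) :=
    h.continuous_apply continuous_subtype_val.inv continuous_const
  -- an approximate unit
  let f : K → ℝ := fun k => max 0 (‖ι v‖ / 4 - ‖π (k : G)⁻¹ (ι v) - ι v‖)
  have hf : Continuous f :=
    continuous_const.max (continuous_const.sub (hvc.sub continuous_const).norm)
  have hf0 : ∀ k, 0 ≤ f k := fun k => le_max_left _ _
  let I : ℝ := ∫ k, f k ∂μ
  have hI : 0 < I := hf.integral_pos_of_hasCompactSupport_nonneg_nonzero (μ := μ) (x := 1)
    (HasCompactSupport.of_compactSpace _) hf0 (by simpa [f] using hpos.not_ge)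
  let f' : C(K, ℂ) := ⟨fun k => (f k : ℂ), by fun_prop⟩
  -- The bump depends on `k` only through `ρ k`, so left finite functions approximate it uniformly.
  have hmem := (leftFinite K).mem_topologicalClosure_of_not_separated f' fun k k' hk => by
    have := h.π_inv_eq (hρ.eq_of_forall_leftFinite hk)
    simp [f', f, this]
  set r : ℝ := μ.real Set.univ
  have hr : 0 ≤ r := measureReal_nonneg
  -- Small enough that both `δ * r` and `δ * r * C` are at most `I / 4`.
  let δ : ℝ := I / (4 * (C + 1) * (r + 1))
  have hδ : 0 < δ := by positivity
  have hδr : δ * r * (C + 1) ≤ I / 4 := by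
    have h1 : δ * (r + 1) * (C + 1) = I / 4 := by
      simp only [δ]
      field_simp
    nlinarith [mul_pos hδ (by linarith : 0 < C + 1)]
  obtain ⟨a, ha, haf⟩ := Metric.mem_closure_iff.1 hmem δ hδ
  have haf' : ∀ k, ‖a k - f k‖ ≤ δ := fun k => by
    have h1 := (f' - a).norm_coe_le_norm k
    rw [dist_eq_norm] at haf
    rw [norm_sub_rev]
    exact h1.trans haf.le
  obtain ⟨w, hw⟩ := h.exists_average_eq_inner μ hρ η ha
  obtain ⟨ζ, hζ, hζn⟩ := h.exists_average μ a a.continuous (HasCompactSupport.of_compactSpace _)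
    (fun k : K => (k : G)) continuous_subtype_val η
  have hζw : ζ = ξ w := h.conjDual_ext fun v => by rw [hζ, hw, hξ]
  have hfi : Integrable f μ := integrable_of_continuous μ hf
  have hδi : Integrable (fun _ : K => δ) μ := integrable_const δ
  have hnorm : ∫ k, ‖a k‖ ∂μ ≤ I + δ * r := by
    calc ∫ k, ‖a k‖ ∂μ ≤ ∫ k, (f k + δ) ∂μ := by
          refine integral_mono (integrable_of_continuous μ a.continuous.norm) (hfi.add hδi)
            fun k => ?_
          have h1 : ‖a k‖ ≤ ‖a k - f k‖ + ‖(f k : ℂ)‖ := norm_le_norm_sub_add _ _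
          rw [Complex.norm_of_nonneg (hf0 k)] at h1
          linarith [haf' k]
      _ = I + δ * r := by
          rw [integral_add hfi hδi, integral_const, smul_eq_mul, mul_comm]
  have hw1 : ‖inner ℂ v w‖ ≤ m * (C * (I + δ * r)) := by
    refine (hv w).trans (mul_le_mul_of_nonneg_left ?_ hm)
    rw [← hζw]
    refine hζn.trans ?_
    calc C * ‖η‖ * ∫ k, ‖a k‖ ∂μ ≤ C * 1 * (I + δ * r) := by gcongr
      _ = _ := by ring
  have hdiff : ‖inner ℂ v w - (I : ℂ) * ‖ι v‖‖ ≤ δ * (C * ‖ι v‖) * r + I * (‖ι v‖ / 4) := by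
    have h1 : Integrable (fun k : K => a k * η (π (k : G)⁻¹ (ι v))) μ :=
      integrable_of_continuous μ (a.continuous.mul (η.continuous.comp hvc))
    have h2 : Integrable (fun k : K => (f k : ℂ) * ‖ι v‖) μ :=
      integrable_of_continuous μ (by fun_prop)
    have h3 : (I : ℂ) * ‖ι v‖ = ∫ k : K, (f k : ℂ) * ‖ι v‖ ∂μ := by
      rw [integral_mul_const, integral_complex_ofReal]
    rw [← hw, h3, ← integral_sub h1 h2]
    calc _ ≤ ∫ k : K, (δ * (C * ‖ι v‖) + f k * (‖ι v‖ / 4)) ∂μ := by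
          refine norm_integral_le_of_norm_le ((integrable_const _).add (hfi.mul_const _))
            (.of_forall fun k => ?_)
          have h4 : a k * η (π (k : G)⁻¹ (ι v)) - (f k : ℂ) * ‖ι v‖ =
              (a k - f k) * η (π (k : G)⁻¹ (ι v)) + f k * η (π (k : G)⁻¹ (ι v) - ι v) := by
            rw [map_sub, hη]
            ring
          rw [h4]
          refine (norm_add_le _ _).trans (add_le_add ?_ ?_)
          · rw [norm_mul]
            refine mul_le_mul (haf' k) ?_ (norm_nonneg _) hδ.le
            refine (h.norm_apply_le η _ _).trans ?_
            calc C * ‖η‖ * ‖ι v‖ ≤ C * 1 * ‖ι v‖ := by gcongr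
              _ = _ := by ring
          · rw [norm_mul, Complex.norm_of_nonneg (hf0 k)]
            rcases (hf0 k).eq_or_lt with h0 | h0
            · simp [← h0]
            · refine mul_le_mul_of_nonneg_left ?_ (hf0 k)
              have h5 : ‖η (π (k : G)⁻¹ (ι v) - ι v)‖ ≤ 1 * ‖π (k : G)⁻¹ (ι v) - ι v‖ :=
                η.le_of_opNorm_le hη1 _
              have h6 : 0 < ‖ι v‖ / 4 - ‖π (k : G)⁻¹ (ι v) - ι v‖ := by
                by_contra hle
                exact h0.ne' (max_eq_left (not_lt.1 hle))
              linarith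
      _ = _ := by
          rw [integral_add (integrable_const _) (hfi.mul_const _), integral_const,
            integral_mul_const, smul_eq_mul]
          ring
  -- The two error terms absorb at most half of `I ‖ι v‖`, and the main term is at most `2 m C I`;
  -- this gives the constant `4 C`.
  have hfinal : I * ‖ι v‖ ≤ m * (C * (I + δ * r)) + (δ * (C * ‖ι v‖) * r + I * (‖ι v‖ / 4)) := by
    have h1 : ‖(I : ℂ) * ‖ι v‖‖ = I * ‖ι v‖ := by
      rw [norm_mul, Complex.norm_of_nonneg hI.le, Complex.norm_of_nonneg hpos.le]
    have h2 := norm_sub_norm_le ((I : ℂ) * ‖ι v‖) (inner ℂ v w)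
    rw [norm_sub_rev, h1] at h2
    linarith
  have hδr0 : 0 ≤ δ * r := by positivity
  have h1 : δ * r ≤ I / 4 := by nlinarith
  have h2 : δ * r * C ≤ I / 4 := by nlinarith
  have h3 : m * (C * (I + δ * r)) ≤ m * (C * (2 * I)) := by gcongr; linarith
  have h4 : δ * (C * ‖ι v‖) * r ≤ I / 4 * ‖ι v‖ := by
    calc _ = δ * r * C * ‖ι v‖ := by ring
      _ ≤ _ := by gcongr
  have h5 : I * ‖ι v‖ ≤ I * (4 * C * m) := by linarith
  exact le_of_mul_le_mul_left h5 hI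

/-- A uniformly bounded family of operators is jointly continuous on the closure of a set of vectors
with continuous orbit maps. -/
theorem continuous_uncurry_of_subset_closure {G F : Type*} [TopologicalSpace G]
    [NormedAddCommGroup F] [NormedSpace ℂ F] (T : G → F →L[ℂ] F) {C : ℝ} (hC : 0 < C)
    (hT : ∀ g x, ‖T g x‖ ≤ C * ‖x‖) {D S : Set F} (hS : S ⊆ closure D)
    (h : ∀ v ∈ D, Continuous fun g => T g v) : Continuous fun x : G × S => T x.1 x.2 := by
  refine continuous_iff_continuousAt.2 fun ⟨g₀, x₀⟩ => Metric.tendsto_nhds.2 fun ε hε => ?_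
  have hδ : 0 < ε / (4 * C) := by positivity
  obtain ⟨v, hvD, hv⟩ := Metric.mem_closure_iff.1 (hS x₀.2) _ hδ
  have h1 : ∀ᶠ x : G × S in 𝓝 (g₀, x₀), dist (x.2 : F) x₀ < ε / (4 * C) :=
    (Metric.tendsto_nhds.1 (continuous_snd.tendsto (g₀, x₀))) _ hδ
  have h2 : ∀ᶠ x : G × S in 𝓝 (g₀, x₀), dist (T x.1 v) (T g₀ v) < ε / 4 :=
    (Metric.tendsto_nhds.1 (((h v hvD).comp continuous_fst).tendsto (g₀, x₀))) _ (by positivity)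
  filter_upwards [h1, h2] with ⟨g, x⟩ h1 h2
  simp only [dist_eq_norm] at *
  have h3 : T g (x : F) - T g₀ (x₀ : F) =
      T g ((x : F) - (x₀ : F)) + T g ((x₀ : F) - v) + (T g v - T g₀ v) - T g₀ ((x₀ : F) - v) := by
    simp only [map_sub]; abel
  have h4 := hT g ((x : F) - (x₀ : F))
  have h5 := hT g ((x₀ : F) - v)
  have h6 := hT g₀ ((x₀ : F) - v)
  have h7 : C * (ε / (4 * C)) = ε / 4 := by field_simp
  have h8 := mul_lt_mul_of_pos_left h1 hC
  have h9 := mul_lt_mul_of_pos_left hv hC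
  rw [h3]
  have := norm_sub_le (T g ((x : F) - (x₀ : F)) + T g ((x₀ : F) - v) + (T g v - T g₀ v))
    (T g₀ ((x₀ : F) - v))
  have := norm_add₃_le (a := T g ((x : F) - (x₀ : F))) (b := T g ((x₀ : F) - v))
    (c := T g v - T g₀ v)
  linarith

/-! ### The dual norm as an element of `Norm(V)`. -/

namespace IsGlobalModel

variable {G : Type u} [Group G] [TopologicalSpace G] {R : RealReductiveGroup G} {K : Subgroup G}
  {V : Type v} [NormedAddCommGroup V] [InnerProductSpace ℂ V]
  {E : Type v} [NormedAddCommGroup E] [NormedSpace ℂ E] {M : GKModule R K V}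
  {π : G →* (E →L[ℂ] E)} {ι : V →ₗ[ℂ] E} {C : ℝ}
  (h : IsGlobalModel M π ι C) [IsTopologicalGroup G] [LocallyCompactSpace G] [CompactSpace K]
  [MeasurableSpace K] [BorelSpace K] (μ : Measure K) [IsFiniteMeasure μ]
  [μ.IsMulLeftInvariant] [CompleteSpace E] [μ.IsOpenPosMeasure]
  (hρ : IsAdmissibleUnitary M.kAct)
include h hρ μ

/-- The dual norm of a `G`-continuous norm of bounded growth is again such a norm. -/
theorem exists_boundedNorm {ξ : V →ₗ[ℂ] ConjDual E} (hξ : ∀ w v, ξ w (ι v) = inner ℂ v w)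
    (hskew : ∀ (X : R.lieAlgebra) (c : ℝ → G), R.IsExpCurve X c → ∀ v w,
      inner ℂ (M.gAct X v) w = - inner ℂ v (M.gAct X w)) :
    ∃ p : M.BoundedNorm, ∀ w, p.toSeminorm w = ‖ξ w‖ := by
  -- The completion of `V` for the dual norm; on the full conjugate dual `G` need not act
  -- norm-continuously.
  let P := (LinearMap.range ξ).topologicalClosure
  have hPG : ∀ g, ∀ x ∈ P, dualAct π g x ∈ P := by
    intro g
    refine fun x hx => (LinearMap.range ξ).topologicalClosure_minimal
      (t := P.comap (dualAct π g).toLinearMap) ?_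
      ((Submodule.isClosed_topologicalClosure _).preimage (dualAct π g).continuous) hx
    rintro _ ⟨w, rfl⟩
    exact h.dualAct_mem_closure μ hρ hξ g w
  have hcomplete : CompleteSpace P :=
    (Submodule.isClosed_topologicalClosure (LinearMap.range ξ)).completeSpace_coe
  have hξP : ∀ w, ξ w ∈ P := fun w => Submodule.le_topologicalClosure _ ⟨w, rfl⟩
  let ι' : V →ₗ[ℂ] P := ξ.codRestrict P hξP
  have hdense : DenseRange ι' := by
    intro x
    have hx : (x : ConjDual E) ∈ closure (Set.range ξ) := x.2
    rw [closure_subtype]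
    convert hx
    ext y
    constructor
    · rintro ⟨_, ⟨w, rfl⟩, rfl⟩
      exact ⟨w, rfl⟩
    · rintro ⟨w, rfl⟩
      exact ⟨_, ⟨w, rfl⟩, rfl⟩
  let π' : G →* (P →L[ℂ] P) :=
    { toFun := fun g => ((dualAct π g).comp P.subtypeL).codRestrict P fun x => hPG g x x.2
      map_one' := by ext; simp
      map_mul' := fun a b => by
        ext x y
        have := DFunLike.congr_fun (map_mul (dualAct π) a b) (x : ConjDual E)
        exact DFunLike.congr_fun this y }
  have hπ' : ∀ g (x : P), ((π' g x : P) : ConjDual E) = dualAct π g x := fun _ _ => rfl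
  have hbd : ∀ g (x : P), ‖π' g x‖ ≤ C * ‖x‖ := fun g x => h.norm_dualAct_le g x
  have hCpos := h.pos
  have hcont : Continuous fun x : G × P => π' x.1 x.2 := by
    refine continuous_induced_rng.2 (continuous_uncurry_of_subset_closure (fun g => dualAct π g)
      hCpos h.norm_dualAct_le (D := Set.range ξ) (S := P) subset_rfl ?_)
    rintro _ ⟨w, rfl⟩
    exact h.continuous_dualAct μ hρ (hξ w)
  let p : Seminorm ℂ V := (normSeminorm ℂ (ConjDual E)).comp ξ
  have hkι : ∀ (k : K) (v : V), π' k (ι' v) = ι' (M.kAct k v) := fun k v =>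
    Subtype.ext (h.conjDual_ext fun u => by
      rw [hπ', show (ι' v : ConjDual E) = ξ v from rfl, h.dualAct_eq hρ (hξ v)]
      exact (hξ _ _).symm)
  let B : M.Globalization p :=
    { E := P
      ι := ι'
      norm_ι := fun v => rfl
      denseRange_ι := hdense
      π := π'
      continuous_π := hcont
      kFinite_iff := fun x => by
        constructor
        · intro hfd
          let W := (Submodule.span ℂ (Set.range fun k : K => π' k x)).map P.subtype
          have hWk : ∀ k₀ : K, ∀ y ∈ W, dualAct π (k₀ : G) y ∈ W := by
            rintro k₀ _ ⟨y, hy, rfl⟩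
            refine ⟨π' k₀ y, ?_, rfl⟩
            refine Submodule.span_le (p := (Submodule.span ℂ (Set.range fun k : K => π' k x)).comap
              (π' k₀).toLinearMap) |>.2 ?_ hy
            rintro _ ⟨k, rfl⟩
            exact Submodule.subset_span ⟨k₀ * k, by simp⟩
          obtain ⟨w, hw⟩ := h.exists_eq_inner_of_fg hρ (W := W)
            (((Submodule.fg_iff_finiteDimensional _).2 hfd).map _) hWk
            (η := (x : ConjDual E)) ⟨x, Submodule.subset_span ⟨1, by simp⟩, rfl⟩
          exact ⟨w, Subtype.ext (h.conjDual_ext fun v => (hξ w v).trans (hw v).symm)⟩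
        · rintro ⟨v, rfl⟩
          have := M.kAct_finite v
          refine Submodule.finiteDimensional_of_le
            (S₂ := (Submodule.span ℂ (Set.range fun k : K => M.kAct k v)).map ι')
            (Submodule.span_le.2 ?_)
          rintro _ ⟨k, rfl⟩
          exact ⟨_, Submodule.subset_span ⟨k, rfl⟩, (hkι k v).symm⟩
      π_ι := hkι
      hasDerivAt_π_ι := fun X c hc w => by
        have := h.hasDerivAt_dualAct μ hρ hc (hskew X c hc) (hξ w) (hξ _)
        rw [hasDerivAt_iff_isLittleO_nhds_zero, Asymptotics.isLittleO_iff] at this ⊢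
        exact this }
  refine ⟨⟨p, fun v hv => ?_, B, C, hCpos, fun g v => hbd g _⟩, fun w => rfl⟩
  have h0 : ξ v = 0 := norm_eq_zero.1 hv
  have := hξ v v
  rw [h0] at this
  exact inner_self_eq_zero.1 this.symm

end IsGlobalModel

/-! ### Lifting one-parameter subgroups, and local compactness of `G`. -/

section Covering

theorem isDiscrete_of_finite_subgroup {G : Type*} [Group G] [TopologicalSpace G] [T2Space G]
    (N : Subgroup G) (hN : (N : Set G).Finite) : IsDiscrete (N : Set G) :=
  have : Finite (N : Set G) := hN
  ⟨inferInstance⟩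

/-- A one-parameter subgroup in the image of a compact group under a continuous homomorphism with
finite kernel can be lifted. -/
theorem exists_lift_of_compact {K H : Type*} [Group K] [TopologicalSpace K] [IsTopologicalGroup K]
    [T2Space K] [CompactSpace K] [Group H] [TopologicalSpace H] [T2Space H] (f : K →* H)
    (hf : Continuous f) (hker : (f.ker : Set K).Finite) (γ : ℝ → H) (hγ : Continuous γ)
    (hadd : ∀ s t, γ (s + t) = γ s * γ t) (hmem : ∀ t, γ t ∈ f.range) :
    ∃ c : ℝ → K, Continuous c ∧ (∀ s t, c (s + t) = c s * c t) ∧ ∀ t, f (c t) = γ t := by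
  have hfr : Continuous f.rangeRestrict := hf.subtype_mk _
  have hq : IsQuotientMap f.rangeRestrict :=
    hfr.isClosedMap.isQuotientMap hfr f.rangeRestrict_surjective
  have hcov : IsCoveringMap f.rangeRestrict :=
    (hq.isQuotientCoveringMap_of_isDiscrete_ker_monoidHom
      (isDiscrete_of_finite_subgroup _ (by rwa [MonoidHom.ker_rangeRestrict]))).isCoveringMap
  have hγ0 : γ 0 = 1 := by
    have := hadd 0 0
    rw [add_zero] at this
    exact left_eq_mul.1 this
  let γ' : C(ℝ, f.range) := ⟨fun t => ⟨γ t, hmem t⟩, hγ.subtype_mk _⟩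
  obtain ⟨c, ⟨hc0, hc⟩, -⟩ := hcov.existsUnique_continuousMap_lifts γ' 0 1
    (Subtype.ext (by simp [γ', hγ0]))
  have hfc : ∀ t, f (c t) = γ t := fun t => congrArg Subtype.val (congrFun hc t)
  refine ⟨c, c.continuous, fun s t => ?_, hfc⟩
  -- Both sides lift the same path and agree at `t = 0`, so uniqueness of lifts makes `c` a
  -- homomorphism.
  refine congrFun (hcov.eq_of_comp_eq (g₁ := fun t => c (s + t)) (g₂ := fun t => c s * c t)
    (by fun_prop) (by fun_prop) ?_ 0 ?_) t
  · ext t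
    simp [hfc, hadd]
  · simp [hc0]

end Covering

namespace RealReductiveGroup

variable {G : Type*} [Group G] [TopologicalSpace G] (R : RealReductiveGroup G)

theorem locallyCompactSpace_generalLinear (n : ℕ) : LocallyCompactSpace (GL (Fin n) ℝ) := by
  have : LocallyCompactSpace (Matrix (Fin n) (Fin n) ℝ) :=
    inferInstanceAs (LocallyCompactSpace (Fin n → Fin n → ℝ))
  let : NormedRing (Matrix (Fin n) (Fin n) ℝ) := Matrix.linftyOpNormedRing
  let : NormedAlgebra ℝ (Matrix (Fin n) (Fin n) ℝ) := Matrix.linftyOpNormedAlgebra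
  have : CompleteSpace (Matrix (Fin n) (Fin n) ℝ) := FiniteDimensional.complete ℝ _
  exact (Units.isOpenEmbedding_val (R := Matrix (Fin n) (Fin n) ℝ)).locallyCompactSpace

theorem isClosed_realPoints : IsClosed (R.realPoints : Set (GL (Fin R.n) ℝ)) := by
  have h : (R.realPoints : Set (GL (Fin R.n) ℝ)) = ⋂ f ∈ R.eqs,
      {g : GL (Fin R.n) ℝ | MvPolynomial.aeval
      (fun ij : Fin R.n × Fin R.n => (((g : Matrix (Fin R.n) (Fin R.n) ℝ) ij.1 ij.2 : ℝ) : ℂ)) f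
        = 0} := by
    ext g
    rw [R.realPoints_eq]
    simp only [Subgroup.coe_comap, Set.mem_preimage, SetLike.mem_coe, R.mem_complexPoints,
      Set.mem_iInter, Set.mem_ofPred_eq]
    rfl
  rw [h]
  refine isClosed_biInter fun f _ => isClosed_eq ?_ continuous_const
  simp only [MvPolynomial.aeval_def, MvPolynomial.eval₂_eq]
  have h1 : ∀ i j, Continuous fun g : GL (Fin R.n) ℝ =>
      (((g : Matrix (Fin R.n) (Fin R.n) ℝ) i j : ℝ) : ℂ) := fun i j =>
    Complex.continuous_ofReal.comp (Units.continuous_val.matrix_elem i j)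
  exact continuous_finsetSum _ fun m _ => continuous_const.mul
    (continuous_finsetProd _ fun i _ => (h1 _ _).pow _)

/-- `G` covers an open subgroup of the closed subgroup of real points of `GL(n, ℝ)`, so local
compactness lifts through a local homeomorphism. It is needed for Haar measure on `G`. -/
theorem locallyCompactSpace (R : RealReductiveGroup G) [IsTopologicalGroup G] [T2Space G] :
    LocallyCompactSpace G := by
  have h1 := locallyCompactSpace_generalLinear R.n
  have h2 : LocallyCompactSpace R.realPoints :=
    R.isClosed_realPoints.isClosedEmbedding_subtypeVal.locallyCompactSpace
  have hopen : IsOpen (R.proj.range : Set R.realPoints) := by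
    rw [MonoidHom.coe_range]
    exact R.isOpenMap_proj.isOpen_range
  have h3 : LocallyCompactSpace R.proj.range := hopen.isOpenEmbedding_subtypeVal.locallyCompactSpace
  have hq : IsQuotientMap R.proj.rangeRestrict := by
    refine IsOpenMap.isQuotientMap ?_ (R.continuous_proj.subtype_mk _)
      R.proj.rangeRestrict_surjective
    exact R.isOpenMap_proj.subtype_mk _
  have hcov : IsCoveringMap R.proj.rangeRestrict :=
    (hq.isQuotientCoveringMap_of_isDiscrete_ker_monoidHom
      (isDiscrete_of_finite_subgroup _
        (by rw [MonoidHom.ker_rangeRestrict]; exact R.finite_ker))).isCoveringMap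
  obtain ⟨e, he, -⟩ := hcov.isLocalHomeomorph 1
  obtain ⟨S, hS, hSe, hSc⟩ := local_compact_nhds (e.open_target.mem_nhds (e.map_source he))
  refine (hSc.image_of_continuousOn (e.continuousOn_symm.mono hSe))
    |>.locallyCompactSpace_of_mem_nhds_of_group
    (x := 1) ?_
  rw [← e.left_inv he]
  exact e.symm.image_mem_nhds (e.map_source he) hS

variable {R} {K : Subgroup G}

/-- A generator of `𝔨` exponentiates only in the matrix image of `K`. Lifting the curve to `K` makes
`kAct_deriv` applicable. -/
theorem exists_isExpCurve [IsTopologicalGroup G] [T2Space G] [CompactSpace K]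
    {X : R.lieAlgebraOf K} (hX : ∀ t : ℝ, ∃ h ∈ K.map R.toGL,
      (h : Matrix (Fin R.n) (Fin R.n) ℝ) =
        NormedSpace.exp (t • (X : Matrix (Fin R.n) (Fin R.n) ℝ))) :
    ∃ c : ℝ → K, R.IsExpCurve (LieSubalgebra.inclusion (R.lieAlgebraOf_le K) X)
      fun t => (c t : G) := by
  choose γ hγK hγ using hX
  have hexp : ∀ s t : ℝ, NormedSpace.exp ((s + t) • (X : Matrix (Fin R.n) (Fin R.n) ℝ)) =
      NormedSpace.exp (s • (X : Matrix (Fin R.n) (Fin R.n) ℝ)) *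
        NormedSpace.exp (t • (X : Matrix (Fin R.n) (Fin R.n) ℝ)) := fun s t => by
    rw [add_smul]
    exact Matrix.exp_add_of_commute _ _ (((Commute.refl _).smul_left s).smul_right t)
  have hadd : ∀ s t, γ (s + t) = γ s * γ t := fun s t => Units.ext (by
    rw [Units.val_mul, hγ, hγ, hγ, hexp])
  have hneg : ∀ t, (γ t)⁻¹ = γ (-t) := fun t => by
    rw [inv_eq_iff_mul_eq_one, ← hadd, add_neg_cancel]
    exact Units.ext (by simp [hγ])
  have hcexp : Continuous fun t : ℝ =>
      NormedSpace.exp (t • (X : Matrix (Fin R.n) (Fin R.n) ℝ)) := by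
    let : NormedRing (Matrix (Fin R.n) (Fin R.n) ℝ) := Matrix.linftyOpNormedRing
    let : NormedAlgebra ℝ (Matrix (Fin R.n) (Fin R.n) ℝ) := Matrix.linftyOpNormedAlgebra
    let : NormedAlgebra ℚ (Matrix (Fin R.n) (Fin R.n) ℝ) := Matrix.linftyOpNormedAlgebra
    exact NormedSpace.exp_continuous.comp (continuous_id.smul continuous_const)
  have hcont : Continuous γ := by
    refine Units.continuous_iff.2 ⟨by simpa [Function.comp_def, hγ] using hcexp, ?_⟩
    simpa [hneg, hγ, Function.comp_def] using hcexp.comp continuous_neg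
  have hker : ((R.toGL.comp K.subtype).ker : Set K).Finite := by
    refine Set.Finite.of_finite_image (f := K.subtype) (R.finite_ker.subset ?_)
      K.subtype_injective.injOn
    rintro _ ⟨k, hk, rfl⟩
    exact Subtype.ext hk
  obtain ⟨c, hc, hcadd, hcγ⟩ := exists_lift_of_compact (R.toGL.comp K.subtype)
    (R.continuous_toGL.comp continuous_subtype_val) hker γ hcont hadd fun t => by
      obtain ⟨k, hk, hkγ⟩ := hγK t
      exact ⟨⟨k, hk⟩, hkγ⟩
  refine ⟨c, continuous_subtype_val.comp hc, fun s t => by rw [hcadd]; rfl, fun t => ?_⟩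
  exact (congrArg Units.val (hcγ t)).trans (hγ t)

end RealReductiveGroup

/-! ### Skewness of the Lie algebra actions. -/

section Skew

variable {V : Type*} [NormedAddCommGroup V] [InnerProductSpace ℂ V]

/-- Polarization gives the real part; replacing `w` by `Complex.I • w` gives the imaginary part. -/
theorem inner_skew_of_re_eq_zero {T : Module.End ℂ V} (hT : ∀ v, (inner ℂ v (T v)).re = 0)
    (v w : V) : inner ℂ (T v) w = - inner ℂ v (T w) := by
  have h1 : ∀ v w, (inner ℂ v (T w)).re = - (inner ℂ w (T v)).re := fun v w => by
    have := hT (v + w)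
    simp only [map_add, inner_add_left, inner_add_right, Complex.add_re, hT] at this
    linarith
  have h2 := h1 v (Complex.I • w)
  have h3 : inner ℂ (T v) w = starRingEnd ℂ (inner ℂ w (T v)) := (inner_conj_symm _ _).symm
  simp only [map_smul, inner_smul_left, inner_smul_right] at h2
  rw [h3]
  apply Complex.ext
  · rw [Complex.conj_re, Complex.neg_re, h1 v w, neg_neg]
  · rw [Complex.conj_im, Complex.neg_im]
    simp at h2
    linarith

namespace GKModule

variable {G : Type*} [Group G] [TopologicalSpace G] [IsTopologicalGroup G] [T2Space G]
  {R : RealReductiveGroup G} {K : Subgroup G} [CompactSpace K] (M : GKModule R K V)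

/-- The action of an element of `𝔨`. -/
abbrev kLieAct (X : R.lieAlgebraOf K) : Module.End ℂ V :=
  M.gAct (LieSubalgebra.inclusion (R.lieAlgebraOf_le K) X)

/-- `𝔨` is a Lie span of exponentiable directions, so a property stable under linear combinations
and commutators need only be checked where differentiation along a curve in `K` is possible. -/
theorem lieAlgebraOf_induction {p : Module.End ℂ V → Prop}
    (mem : ∀ (X : R.lieAlgebraOf K) (c : ℝ → K),
      R.IsExpCurve (LieSubalgebra.inclusion (R.lieAlgebraOf_le K) X) (fun t => (c t : G)) →
      p (M.kLieAct X))
    (zero : p 0) (add : ∀ S T, p S → p T → p (S + T)) (smul : ∀ (r : ℝ) S, p S → p (r • S))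
    (lie : ∀ S T, p S → p T → p (S * T - T * S)) (X : R.lieAlgebraOf K) : p (M.kLieAct X) := by
  have key : ∀ (x : Matrix (Fin R.n) (Fin R.n) ℝ) (hx : x ∈ R.lieAlgebraOf K),
      p (M.kLieAct ⟨x, hx⟩) := by
    intro x hx
    refine LieSubalgebra.lieSpan_induction (R := ℝ)
      (s := {X | ∀ t : ℝ, ∃ h ∈ K.map R.toGL, (h : Matrix (Fin R.n) (Fin R.n) ℝ) =
        NormedSpace.exp (t • X)})
      (p := fun x hx => p (M.kLieAct ⟨x, show x ∈ R.lieAlgebraOf K from hx⟩))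
      ?_ ?_ ?_ ?_ ?_ hx
    · intro x hx
      obtain ⟨c, hc⟩ := RealReductiveGroup.exists_isExpCurve (R := R) (K := K)
        (X := ⟨x, LieSubalgebra.subset_lieSpan hx⟩) hx
      exact mem _ c hc
    · have : M.kLieAct 0 = 0 := by simp [kLieAct]
      exact this ▸ zero
    · intro x y hx hy h1 h2
      have : M.kLieAct (⟨x, hx⟩ + ⟨y, hy⟩) = M.kLieAct ⟨x, hx⟩ + M.kLieAct ⟨y, hy⟩ := by
        simp [kLieAct]
      exact this ▸ add _ _ h1 h2
    · intro r x hx h1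
      have : M.kLieAct (r • ⟨x, hx⟩) = r • M.kLieAct ⟨x, hx⟩ := by
        simp [kLieAct]
      exact this ▸ smul _ _ h1
    · intro x y hx hy h1 h2
      have : M.kLieAct ⁅(⟨x, hx⟩ : R.lieAlgebraOf K), ⟨y, hy⟩⁆ =
          M.kLieAct ⟨x, hx⟩ * M.kLieAct ⟨y, hy⟩ - M.kLieAct ⟨y, hy⟩ * M.kLieAct ⟨x, hx⟩ := by
        simp [kLieAct, Ring.lie_def]
      exact this ▸ lie _ _ h1 h2
  exact key X X.2

theorem kLieAct_mem {U : Submodule ℂ V} (hU : ∀ k, U ≤ U.comap (M.kAct k)) (X : R.lieAlgebraOf K) :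
    U ≤ U.comap (M.kLieAct X) := by
  refine M.lieAlgebraOf_induction (p := fun T => U ≤ U.comap T) ?_ ?_ ?_ ?_ ?_ X
  · intro X c hc v hv
    by_contra hmem
    rw [Submodule.mem_comap] at hmem
    -- The derivative is only known weakly; a functional that kills `U` but not `X v` contradicts
    -- it, as the curve stays in `U`.
    obtain ⟨l, hl, hlU⟩ := Submodule.exists_le_ker_of_notMem hmem
    have h1 := M.kAct_deriv X c hc v l
    have h2 : (fun t => l (M.kAct (c t) v)) = fun _ => 0 := funext fun t => by
      have : M.kAct (c t) v ∈ U := hU (c t) hv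
      exact hlU this
    rw [h2] at h1
    exact hl (h1.unique (hasDerivAt_const _ _))
  · exact fun v _ => U.zero_mem
  · exact fun S T hS hT v hv => U.add_mem (hS hv) (hT hv)
  · intro r S hS v hv
    exact U.smul_mem (r : ℂ) (hS hv)
  · exact fun S T hS hT v hv => U.sub_mem (hS (hT hv)) (hT (hS hv))

/-- Differentiate `⟨v, c(t) w⟩ = ⟨c(-t) v, w⟩` at `t = 0`. -/
theorem kLieAct_skew (hρ : ∀ k v w, inner ℂ (M.kAct k v) (M.kAct k w) = inner ℂ v w)
    (X : R.lieAlgebraOf K) (v w : V) : inner ℂ (M.kLieAct X v) w = - inner ℂ v (M.kLieAct X w) := by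
  refine M.lieAlgebraOf_induction
    (p := fun T => ∀ v w, inner ℂ (T v) w = - inner ℂ v (T w)) ?_ ?_ ?_ ?_ ?_ X v w
  · intro X c hc v w
    have h1 := M.kAct_deriv X c hc w (innerₛₗ ℂ v)
    have h2 : HasDerivAt (fun t => inner ℂ w (M.kAct (c (-t)) v))
        (- inner ℂ w (M.kLieAct X v)) 0 := by
      simpa [Function.comp_def] using
        (M.kAct_deriv X c hc v (innerₛₗ ℂ w)).scomp_of_eq (0 : ℝ) (hasDerivAt_neg 0) neg_zero.symm
    have h3 : (fun t => star (inner ℂ w (M.kAct (c (-t)) v))) =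
        fun t => innerₛₗ ℂ v (M.kAct (c t) w) := by
      funext t
      have hct : c (-t) = (c t)⁻¹ := Subtype.ext (hc.map_neg t)
      have := hρ (c t) (M.kAct (c (-t)) v) w
      rw [hct, Representation.self_inv_apply] at this
      rw [hct, innerₛₗ_apply_apply, this]
      exact inner_conj_symm _ _
    have h4 := h2.star
    rw [h3] at h4
    have h5 := h1.unique h4
    rw [innerₛₗ_apply_apply] at h5
    rw [h5, star_neg, neg_neg]
    exact (inner_conj_symm _ _).symm
  · simp
  · intro S T hS hT v w
    rw [LinearMap.add_apply, LinearMap.add_apply, inner_add_left, inner_add_right, hS, hT, neg_add]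
  · intro r S hS v w
    have : ∀ v, (r • S) v = (r : ℂ) • S v := fun _ => rfl
    rw [this, this, inner_smul_left, inner_smul_right, hS, Complex.conj_ofReal, mul_neg]
  · intro S T hS hT v w
    rw [LinearMap.sub_apply, LinearMap.sub_apply, inner_sub_left, inner_sub_right]
    simp only [Module.End.mul_apply, hS, hT, neg_neg, neg_sub]

end GKModule

end Skew

namespace GKModule

variable {G : Type u} [Group G] [TopologicalSpace G] {R : RealReductiveGroup G} {K : Subgroup G}

section Isometric

variable {V : Type v} [NormedAddCommGroup V] [InnerProductSpace ℂ V] {M : GKModule R K V}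
  {p : Seminorm ℂ V} (hp : ∀ v, p v = ‖v‖) (B : M.Globalization p)
  (hB : ∀ (g : G) (x : B.E), ‖B.π g x‖ = ‖x‖)
include hp hB

/-- With `w = X v`, the norm of `v + t w` differs by `o(t)` from that of the orbit curve, which is
constant. Hence `2 Re ⟨v, w⟩`, the derivative of `‖v + t w‖²` at `0`, vanishes. -/
theorem Globalization.re_inner_gAct_eq_zero {X : R.lieAlgebra} {c : ℝ → G} (hc : R.IsExpCurve X c)
    (v : V) : (inner ℂ v (M.gAct X v)).re = 0 := by
  set w := M.gAct X v with hw
  have hι : ∀ v, ‖B.ι v‖ = ‖v‖ := fun v => (B.norm_ι v).trans (hp v)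
  have h1 := B.hasDerivAt_π_ι X c hc v
  rw [hasDerivAt_iff_isLittleO_nhds_zero] at h1
  have h2 : HasDerivAt (fun t : ℝ => ‖v + (t : ℂ) • w‖) 0 0 := by
    rw [hasDerivAt_iff_isLittleO_nhds_zero]
    refine (Asymptotics.IsBigO.of_bound 1 (Filter.Eventually.of_forall fun t => ?_))
      |>.trans_isLittleO h1
    have h3 : ‖v + (t : ℂ) • w‖ = ‖B.ι v + t • B.ι w‖ := by
      rw [← hι, map_add, map_smul]
      rfl
    have h4 : ‖v‖ = ‖B.π (c t) (B.ι v)‖ := by rw [hB, hι]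
    have h5 := abs_norm_sub_norm_le (B.ι v + t • B.ι w) (B.π (c t) (B.ι v))
    simp only [zero_add, Complex.ofReal_zero, zero_smul, add_zero, smul_zero, sub_zero, one_mul,
      hc.map_zero, map_one, one_apply_eq_self]
    rw [h3, h4, Real.norm_eq_abs]
    refine h5.trans_eq ?_
    rw [← norm_neg]
    congr 1
    abel
  have h3 := h2.pow 2
  have h4 : (fun t : ℝ => ‖v + (t : ℂ) • w‖) ^ 2 =
      fun t : ℝ => ‖v‖ ^ 2 + t * (2 * (inner ℂ v w).re) + t ^ 2 * ‖w‖ ^ 2 := by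
    funext t
    rw [Pi.pow_apply, norm_add_sq (𝕜 := ℂ), inner_smul_right, norm_smul, mul_pow,
      RCLike.re_to_complex, Complex.re_ofReal_mul, Complex.norm_real, Real.norm_eq_abs, sq_abs]
    ring
  rw [h4] at h3
  have h5 := (((hasDerivAt_id (0 : ℝ)).mul_const (2 * (inner ℂ v w).re)).const_add
    (‖v‖ ^ 2)).add (((hasDerivAt_id (0 : ℝ)).pow 2).mul_const (‖w‖ ^ 2))
  have h6 := h3.unique h5
  simpa using h6.symm

theorem Globalization.isAdmissibleUnitary (hM : M.IsHarishChandra) :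
    IsAdmissibleUnitary M.kAct where
  inner_map k := (LinearMap.norm_map_iff_inner_map_map (M.kAct k)).1 fun v => by
    rw [← hp, ← B.norm_ι, ← B.π_ι, hB, B.norm_ι, hp]
  locallyFinite v := by
    refine ⟨Submodule.span ℂ (Set.range fun k : K => M.kAct k v),
      (Submodule.fg_iff_finiteDimensional _).2 (M.kAct_finite v),
      Submodule.subset_span ⟨1, by simp⟩, fun k => Submodule.span_le.2 ?_⟩
    rintro _ ⟨k', rfl⟩
    exact Submodule.subset_span ⟨k * k', by simp⟩
  weaklyContinuous := M.kAct_continuous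
  finiteMultiplicities d τ hτ hτc := by
    have := hM.admissible d τ hτ fun w => continuous_pi fun i => hτc w (LinearMap.proj i)
    exact homK_fg_of_finiteDimensional τ M.kAct

end Isometric

section Dual

variable {V : Type v} [NormedAddCommGroup V] [InnerProductSpace ℂ V] {M : GKModule R K V}

theorem BoundedNorm.exists_isGlobalModel (p : M.BoundedNorm) :
    ∃ (B : M.Globalization p.toSeminorm) (C : ℝ), IsGlobalModel M B.π B.ι C := by
  obtain ⟨B, C, hC, hB⟩ := p.exists_globalization
  refine ⟨B, C, ⟨⟨B.continuous_π, ?_, B.denseRange_ι, B.π_ι, hC, fun g x => ?_⟩,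
    fun x => (B.kFinite_iff x).1, B.hasDerivAt_π_ι⟩⟩
  · refine (injective_iff_map_eq_zero _).2 fun v hv => p.eq_zero v ?_
    rw [← B.norm_ι, hv, norm_zero]
  · refine B.denseRange_ι.induction_on x (isClosed_le (by fun_prop) (by fun_prop)) fun v => ?_
    rw [B.norm_ι]
    exact hB g v

/-- The dual norm of a norm in `Norm(V)` belongs to `Norm(V)`, and its dual norm is equivalent to
the given one. -/
theorem BoundedNorm.exists_dual [IsTopologicalGroup G] [T2Space G] (hK : IsCompact (K : Set G))
    (hρ : IsAdmissibleUnitary M.kAct)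
    (hskew : ∀ (X : R.lieAlgebra) (c : ℝ → G), R.IsExpCurve X c → ∀ v w,
      inner ℂ (M.gAct X v) w = - inner ℂ v (M.gAct X w)) (p : M.BoundedNorm) :
    ∃ p' : M.BoundedNorm,
      (∀ v w, ‖inner ℂ v w‖ ≤ p'.toSeminorm w * p.toSeminorm v) ∧
      (∀ w m, 0 ≤ m → (∀ v, ‖inner ℂ v w‖ ≤ m * p.toSeminorm v) → p'.toSeminorm w ≤ m) ∧
      ∃ D, 0 < D ∧ ∀ v m, 0 ≤ m → (∀ w, ‖inner ℂ v w‖ ≤ m * p'.toSeminorm w) →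
        p.toSeminorm v ≤ D * m := by
  have := R.locallyCompactSpace
  have : CompactSpace K := isCompact_iff_compactSpace.1 hK
  borelize ↥K
  obtain ⟨B, C, h⟩ := p.exists_isGlobalModel
  let μ : Measure K := Measure.haar
  obtain ⟨ξ, hξ⟩ := h.exists_conjDual μ hρ
  obtain ⟨p', hp'⟩ := h.exists_boundedNorm μ hρ hξ hskew
  refine ⟨p', fun v w => ?_, fun w m hm hw => ?_, 4 * C, by linarith [h.pos], fun v m hm hv => ?_⟩
  · rw [hp', ← hξ, ← B.norm_ι]
    exact (ξ w).le_opNorm _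
  · rw [hp']
    refine h.opNorm_le_of_forall _ hm fun v => ?_
    rw [hξ, B.norm_ι]
    exact hw v
  · rw [← B.norm_ι]
    refine h.norm_le_of_forall_inner μ hρ hξ hm fun w => ?_
    rw [← hp']
    exact hv w

end Dual

end GKModule

/-! ### Bessel powers of a positive, locally finite symmetric operator. -/

section Positive

variable {V : Type v} [NormedAddCommGroup V] [InnerProductSpace ℂ V] {T : Module.End ℂ V}
  (hT : T.IsSymmetric)

theorem LinearMap.IsSymmetric.span_eigenvectors_eq_top (hT : T.IsSymmetric)
    (hpos : ∀ v, 0 ≤ (inner ℂ (T v) v).re)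
    (hfin : ∀ v, ∃ U : Submodule ℂ V, U.FG ∧ v ∈ U ∧ U ≤ U.comap T) :
    Submodule.span ℂ {v | ∃ μ : ℝ, 0 ≤ μ ∧ T v = (μ : ℂ) • v} = ⊤ := by
  refine (Submodule.eq_top_iff').2 fun v => ?_
  obtain ⟨U, hU, hv, hTU⟩ := hfin v
  have : FiniteDimensional ℂ U := (Submodule.fg_iff_finiteDimensional _).1 hU
  have hS := hT.restrict_invariant hTU
  let b := hS.eigenvectorBasis rfl
  have hb : ∀ i, T (b i) = (hS.eigenvalues rfl i : ℂ) • (b i : V) := fun i =>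
    congrArg Subtype.val (hS.apply_eigenvectorBasis rfl i)
  have h1 : v = ∑ i, b.repr ⟨v, hv⟩ i • (b i : V) := by
    have := congrArg U.subtype (b.sum_repr ⟨v, hv⟩)
    rw [map_sum] at this
    exact this.symm
  rw [h1]
  refine Submodule.sum_mem _ fun i _ => Submodule.smul_mem _ _ (Submodule.subset_span
    ⟨hS.eigenvalues rfl i, ?_, hb i⟩)
  have h2 := hpos (b i)
  have h3 : ‖(b i : V)‖ = 1 := b.orthonormal.norm_eq_one i
  rw [hb, inner_smul_left, inner_self_eq_norm_sq_to_K, h3] at h2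
  simpa using h2

variable (hspan : Submodule.span ℂ {v | ∃ μ : ℝ, 0 ≤ μ ∧ T v = (μ : ℂ) • v} = ⊤)
include hspan

theorem besselPower_add_apply (s t : ℝ) (v : V) :
    besselPower T (s + t) v = besselPower T s (besselPower T t v) := by
  refine LinearMap.congr_fun (f := besselPower T (s + t))
    (g := besselPower T s ∘ₗ besselPower T t) (LinearMap.ext_on hspan ?_) v
  rintro v ⟨μ, hμ, hv⟩
  rw [LinearMap.comp_apply, besselPower_apply T _ μ v hv, besselPower_apply T _ μ v hv, map_smul,
    besselPower_apply T _ μ v hv, smul_smul, add_div, Real.rpow_add (by linarith),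
    Complex.ofReal_mul, mul_comm]

theorem besselPower_zero_apply (v : V) : besselPower T 0 v = v := by
  refine LinearMap.congr_fun (f := besselPower T 0) (g := LinearMap.id)
    (LinearMap.ext_on hspan ?_) v
  rintro v ⟨μ, hμ, hv⟩
  simp [besselPower_apply T _ μ v hv]

theorem besselPower_neg_apply (s : ℝ) (v : V) :
    besselPower T s (besselPower T (-s) v) = v := by
  rw [← besselPower_add_apply hspan, add_neg_cancel, besselPower_zero_apply hspan]

include hT in
theorem besselPower_isSymmetric (s : ℝ) : (besselPower T s).IsSymmetric := by
  intro v w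
  induction (hspan ▸ Submodule.mem_top : v ∈ Submodule.span ℂ _) using Submodule.span_induction with
  | zero => simp
  | add v v' _ _ hv hv' => simp [inner_add_left, hv, hv']
  | smul c v _ hv => simp [inner_smul_left, hv]
  | mem v hv =>
    obtain ⟨μ, -, hv⟩ := hv
    induction (hspan ▸ Submodule.mem_top : w ∈ Submodule.span ℂ _)
      using Submodule.span_induction with
    | zero => simp
    | add w w' _ _ hw hw' => simp [inner_add_right, hw, hw']
    | smul c w _ hw => simp [inner_smul_right, hw]
    | mem w hw =>
      obtain ⟨ν, -, hw⟩ := hw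
      have h1 := hT v w
      rw [hv, hw, inner_smul_left, inner_smul_right, Complex.conj_ofReal] at h1
      rw [besselPower_apply T s μ v hv, besselPower_apply T s ν w hw, inner_smul_left,
        inner_smul_right, Complex.conj_ofReal]
      -- Either the eigenvalues agree or the eigenvectors are orthogonal.
      rcases mul_eq_mul_right_iff.1 h1 with h2 | h2
      · rw [Complex.ofReal_injective h2]
      · rw [h2, mul_zero, mul_zero]

end Positive

/-! ### The Laplacian, duality of Sobolev dominations, and the distances. -/

namespace GKModule

variable {G : Type u} [Group G] [TopologicalSpace G] {R : RealReductiveGroup G} {K : Subgroup G}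
  {V : Type v} [NormedAddCommGroup V] [InnerProductSpace ℂ V] (M : GKModule R K V)
  (Y : R.OrthonormalBasisOf K)

section Laplacian

theorem laplacian_apply (v : V) :
    M.laplacian Y v = -∑ i, M.kLieAct (Y.basis i) (M.kLieAct (Y.basis i) v) := by
  rw [laplacian, LinearMap.neg_apply, LinearMap.sum_apply]
  rfl

variable [IsTopologicalGroup G] [T2Space G] [CompactSpace K] (hρ : IsAdmissibleUnitary M.kAct)
include hρ

theorem laplacian_isSymmetric : (M.laplacian Y).IsSymmetric := by
  intro v w
  simp only [laplacian_apply, inner_neg_left, inner_neg_right, sum_inner, inner_sum,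
    M.kLieAct_skew hρ.inner_map, neg_neg]

theorem re_inner_laplacian_nonneg (v : V) : 0 ≤ (inner ℂ (M.laplacian Y v) v).re := by
  simp only [laplacian_apply, inner_neg_left, sum_inner, ← Finset.sum_neg_distrib,
    M.kLieAct_skew hρ.inner_map _ (M.kLieAct _ v), neg_neg, Complex.re_sum]
  exact Finset.sum_nonneg fun i _ => inner_self_nonneg (𝕜 := ℂ)

theorem span_laplacian_eigenvectors_eq_top :
    Submodule.span ℂ {v | ∃ μ : ℝ, 0 ≤ μ ∧ M.laplacian Y v = (μ : ℂ) • v} = ⊤ := by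
  refine (M.laplacian_isSymmetric Y hρ).span_eigenvectors_eq_top
    (M.re_inner_laplacian_nonneg Y hρ) fun v => ?_
  obtain ⟨U, hU, hv, hk⟩ := hρ.locallyFinite v
  refine ⟨U, hU, hv, fun w hw => ?_⟩
  rw [Submodule.mem_comap, laplacian_apply]
  exact U.neg_mem (U.sum_mem fun i _ => M.kLieAct_mem hk _ (M.kLieAct_mem hk _ hw))

end Laplacian

section Duality

variable {M} {Y} (hsymm : (M.laplacian Y).IsSymmetric)
  (hspan : Submodule.span ℂ {v | ∃ μ : ℝ, 0 ≤ μ ∧ M.laplacian Y v = (μ : ℂ) • v} = ⊤)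
  (hdual : ∀ p : M.BoundedNorm, ∃ p' : M.BoundedNorm,
      (∀ v w, ‖inner ℂ v w‖ ≤ p'.toSeminorm w * p.toSeminorm v) ∧
      (∀ w m, 0 ≤ m → (∀ v, ‖inner ℂ v w‖ ≤ m * p.toSeminorm v) → p'.toSeminorm w ≤ m) ∧
      ∃ D, 0 < D ∧ ∀ v m, 0 ≤ m → (∀ w, ‖inner ℂ v w‖ ≤ m * p'.toSeminorm w) →
        p.toSeminorm v ≤ D * m)
  {q pmin pmax : M.BoundedNorm} (hq : ∀ v, q.toSeminorm v = ‖v‖)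
include hsymm hspan hdual hq

/-- Write `A` for the Bessel power of order `s`. From `|⟨v, w⟩| = |⟨A⁻¹ v, A w⟩| ≤ q(A⁻¹ v) q(A w)`
and the hypothesis, the dual of `pmin` is at most a multiple of `q_s`. Since `pmin` is dominated by
the dual of `pmax`, biduality bounds `pmax` by the dual of `pmin`. -/
theorem dominated_sobolev_of_dominated_sobolev_bot (hmin : ∀ p, pmin ≤ p) {s : ℝ}
    (h : Dominated q.toSeminorm (M.sobolev Y pmin.toSeminorm s)) :
    Dominated pmax.toSeminorm (M.sobolev Y q.toSeminorm s) := by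
  obtain ⟨pn, h1, h2, -⟩ := hdual pmin
  obtain ⟨px, -, -, D, hD, h3⟩ := hdual pmax
  obtain ⟨C₀, hC₀, h4⟩ := hmin px
  obtain ⟨C, hC, h⟩ := h
  have h5 : ∀ w, pn.toSeminorm w ≤ C * q.toSeminorm (besselPower (M.laplacian Y) s w) := by
    intro w
    refine h2 w _ (mul_nonneg hC.le (apply_nonneg _ _)) fun v => ?_
    have h6 := h (besselPower (M.laplacian Y) (-s) v)
    rw [sobolev, Seminorm.comp_apply, besselPower_neg_apply hspan, hq] at h6
    have h7 := besselPower_isSymmetric hsymm hspan s (besselPower (M.laplacian Y) (-s) v) w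
    rw [besselPower_neg_apply hspan] at h7
    rw [h7, hq, mul_right_comm]
    exact (norm_inner_le_norm _ _).trans (mul_le_mul_of_nonneg_right h6 (norm_nonneg _))
  refine ⟨D * C₀ * C, by positivity, fun v => ?_⟩
  have h6 := h3 v (C₀ * pn.toSeminorm v) (mul_nonneg hC₀.le (apply_nonneg _ _)) fun w => by
    rw [norm_inner_symm, mul_comm C₀, mul_assoc]
    exact (h1 w v).trans (mul_le_mul_of_nonneg_left (h4 w) (apply_nonneg _ _))
  rw [← mul_assoc] at h6
  rw [mul_assoc (D * C₀)]
  exact h6.trans (mul_le_mul_of_nonneg_left (h5 v) (by positivity))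

/-- With `A` the Bessel power of order `s`, `‖v‖² = ⟨A v, A⁻¹ v⟩` is at most `pmin(A v)` times the
dual of `pmin` at `A⁻¹ v`. That dual is dominated by `pmax`, and `pmax(A⁻¹ v) ≤ C ‖v‖`; one factor
`‖v‖` cancels. -/
theorem dominated_sobolev_bot_of_dominated_sobolev (hmax : ∀ p, p ≤ pmax) {s : ℝ}
    (h : Dominated pmax.toSeminorm (M.sobolev Y q.toSeminorm s)) :
    Dominated q.toSeminorm (M.sobolev Y pmin.toSeminorm s) := by
  obtain ⟨pn, h1, -, -⟩ := hdual pmin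
  obtain ⟨C₁, hC₁, h2⟩ := hmax pn
  obtain ⟨C, hC, h⟩ := h
  refine ⟨C₁ * C, by positivity, fun v => ?_⟩
  set v₁ := besselPower (M.laplacian Y) s v with hv₁
  set v₂ := besselPower (M.laplacian Y) (-s) v with hv₂
  have h3 : besselPower (M.laplacian Y) s v₂ = v := besselPower_neg_apply hspan s v
  have h4 := h v₂
  rw [sobolev, Seminorm.comp_apply, h3, hq] at h4
  have h5 : ‖v‖ ^ 2 = ‖inner ℂ v₁ v₂‖ := by
    rw [hv₁, besselPower_isSymmetric hsymm hspan, h3, inner_self_eq_norm_sq_to_K]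
    simp
  rw [hq, sobolev, Seminorm.comp_apply, ← hv₁]
  rcases (norm_nonneg v).eq_or_lt with h0 | h0
  · rw [← h0]
    exact mul_nonneg (by positivity) (apply_nonneg _ _)
  refine le_of_mul_le_mul_left ?_ h0
  calc ‖v‖ * ‖v‖ = ‖inner ℂ v₁ v₂‖ := by rw [← h5, sq]
    _ ≤ pn.toSeminorm v₂ * pmin.toSeminorm v₁ := h1 _ _
    _ ≤ (C₁ * (C * ‖v‖)) * pmin.toSeminorm v₁ := by
      refine mul_le_mul_of_nonneg_right ((h2 v₂).trans ?_) (apply_nonneg _ _)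
      exact mul_le_mul_of_nonneg_left h4 hC₁.le
    _ = ‖v‖ * (C₁ * C * pmin.toSeminorm v₁) := by ring

end Duality

section Distance

variable {M} {Y}
  (hspan : Submodule.span ℂ {v | ∃ μ : ℝ, 0 ≤ μ ∧ M.laplacian Y v = (μ : ℂ) • v} = ⊤)
include hspan

theorem sobolev_zero (p : Seminorm ℂ V) : M.sobolev Y p 0 = p :=
  Seminorm.ext fun v => by rw [sobolev, Seminorm.comp_apply, besselPower_zero_apply hspan]

theorem sobolev_sobolev (p : Seminorm ℂ V) (s t : ℝ) :
    M.sobolev Y (M.sobolev Y p s) t = M.sobolev Y p (s + t) :=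
  Seminorm.ext fun v => by
    simp only [sobolev, Seminorm.comp_apply, besselPower_add_apply hspan]

theorem dArrow_eq_zero_of_le {p q : M.BoundedNorm} (h : p ≤ q) : M.dArrow Y p.cls q.cls = 0 := by
  refine le_antisymm ((iInf₂_le (0 : ℝ≥0) ?_).trans_eq ENNReal.coe_zero) bot_le
  rw [NNReal.coe_zero, sobolev_zero hspan]
  exact h

end Distance

/-- The dual norms exchange the smallest and the largest norm. -/
theorem d_bot_eq_d_top_and_sobolevGap_le [IsTopologicalGroup G] [T2Space G]
    (hK : IsCompact (K : Set G)) (hM : M.IsHarishChandra) {q pmin pmax : M.BoundedNorm}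
    (hq : ∀ v, q.toSeminorm v = ‖v‖) (B : M.Globalization q.toSeminorm)
    (hB : ∀ (g : G) (x : B.E), ‖B.π g x‖ = ‖x‖)
    (hmin : IsBot pmin.cls) (hmax : IsTop pmax.cls) :
    M.d Y q.cls pmin.cls = M.d Y q.cls pmax.cls ∧
      M.sobolevGap Y ≤ 2 * M.d Y q.cls pmax.cls := by
  have : CompactSpace K := isCompact_iff_compactSpace.1 hK
  have hmin' : ∀ p, pmin ≤ p := fun p =>
    toAntisymmetrization_le_toAntisymmetrization_iff.1 (hmin p.cls)
  have hmax' : ∀ p, p ≤ pmax := fun p =>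
    toAntisymmetrization_le_toAntisymmetrization_iff.1 (hmax p.cls)
  have hρ := B.isAdmissibleUnitary hq hB hM
  have hsymm := M.laplacian_isSymmetric Y hρ
  have hspan := M.span_laplacian_eigenvectors_eq_top Y hρ
  have hdual := BoundedNorm.exists_dual (M := M) hK hρ fun X c hc =>
    inner_skew_of_re_eq_zero (B.re_inner_gAct_eq_zero hq hB hc)
  have hiff : ∀ s : ℝ, Dominated q.toSeminorm (M.sobolev Y pmin.toSeminorm s) ↔
      Dominated pmax.toSeminorm (M.sobolev Y q.toSeminorm s) := fun s =>
    ⟨dominated_sobolev_of_dominated_sobolev_bot hsymm hspan hdual hq hmin',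
      dominated_sobolev_bot_of_dominated_sobolev hsymm hspan hdual hq hmax'⟩
  have h1 : M.d Y q.cls pmin.cls = M.dArrow Y q.cls pmin.cls := by
    rw [d, dArrow_eq_zero_of_le hspan (hmin' q), max_eq_left zero_le]
  have h2 : M.d Y q.cls pmax.cls = M.dArrow Y pmax.cls q.cls := by
    rw [d, dArrow_eq_zero_of_le hspan (hmax' q), max_eq_right zero_le]
  have h3 : M.dArrow Y q.cls pmin.cls = M.dArrow Y pmax.cls q.cls :=
    iInf_congr fun s => iInf_congr_Prop (hiff s) fun _ => rfl
  refine ⟨by rw [h1, h2, h3], ?_⟩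
  rw [h2]
  change _ ≤ 2 * M.dArrowNorm Y pmax q
  simp only [dArrowNorm, ENNReal.mul_iInf_of_ne two_ne_zero ENNReal.ofNat_ne_top]
  refine le_iInf₂ fun s hs => ?_
  -- The chain is `pmax ≲ q_s ≲ (pmin_s)_s`, and Sobolev orders add.
  refine (iInf₂_le (2 * s) ⟨pmin, pmax, hmin, hmax, ?_⟩).trans_eq (by simp)
  have h4 := M.sobolev_mono Y ((hiff s).2 hs) s
  rw [sobolev_sobolev hspan] at h4
  have h5 : ((2 * s : ℝ≥0) : ℝ) = s + s := by push_cast; ring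
  rw [h5]
  exact hs.trans h4

end GKModule

end

theorem mainTheorem9 {G : Type u} [Group G] [TopologicalSpace G] [IsTopologicalGroup G] [T2Space G]
    (R : RealReductiveGroup G) (hR : R.IsInnerType)
    (K : Subgroup G) (hK : Maximal (fun H : Subgroup G => IsCompact (H : Set G)) K)
    {V : Type v} [AddCommGroup V] [Module ℂ V] (M : GKModule R K V) (hM : M.IsHarishChandra)
    (Y : R.OrthonormalBasisOf K)
    (q : M.BoundedNorm) (hq : q.IsUnitary)
    (pmin pmax : M.BoundedNorm) (hmin : IsBot pmin.cls) (hmax : IsTop pmax.cls) :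
    M.d Y q.cls pmin.cls = M.d Y q.cls pmax.cls ∧
      M.sobolevGap Y ≤ 2 * M.d Y q.cls pmax.cls := by
  obtain ⟨⟨c, hc⟩, B, hB⟩ := hq
  -- The scalar product behind `q` becomes the inner product of `V`, so that `q` is its norm.
  let : NormedAddCommGroup V := c.toNormedAddCommGroup
  let : InnerProductSpace ℂ V := InnerProductSpace.ofCore c.toCore
  have hnorm : ∀ v, q.toSeminorm v = ‖v‖ := fun v => by
    refine (sq_eq_sq₀ (apply_nonneg _ _) (norm_nonneg _)).1 ((hc v).trans ?_)
    exact inner_self_eq_norm_sq (𝕜 := ℂ) v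
  exact M.d_bot_eq_d_top_and_sobolevGap_le Y hK.prop hM hnorm B hB hmin hmax
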